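/- Let $F$ be a non-abelian free group of finite rank, and let $S_1,S_2$ be free bases of $F$. Let $T_i$ be the Cayley graph of $F$ with respect to $S_i$, a tree whose edges are isometric to $[0,1]$. The product square complex $T_1\times T_2$ is the universal cover of the Salvetti complex of $F\times F$, viewed as the right-angled Artin group whose defining graph is the join of $S_1$ and $S_2$; the group $F\times F$ acts on it coordinatewise. For an isometric action of a group $G$ on a metric space $(X,d)$ with base point $o$ and a normal subgroup $N$ of $G$, put $\bar d(gN,g'N)=\inf_{n,n'\in N}d(gn.o,g'n'.o)$ and $$\delta_{G/N}=\limsup_{r\to\infty}\frac1r\log\#\{gN\in G/N : \bar d(N,gN)\le r\},\qquad \delta_G=\delta_{G/\{1\}}.$$ The action is *growth tight* if $\delta_{G/N}<\delta_G$ for every infinite normal subgroup $N$ of $G$. 1. Let $d_E$ be the piecewise Euclidean metric on $T_1\times T_2$, i.e. the length metric in which every square is a Euclidean unit square. On the vertex set $F\times F$ it is the $L^2$ metric of the product, and the action of $F\times F$ on $(T_1\times T_2,d_E)$ is growth tight, for every base point. 2. Let $d_1$ be the length metric on the 1-skeleton of $T_1\times T_2$ in which every edge has length one. On the vertex set $F\times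 F$ it is the $L^1$ metric of the product, and the action of $F\times F$ on the 1-skeleton with the metric $d_1$ is not growth tight, for any base point. -/

import Mathlib

open Filter
open scoped ENNReal unitInterval

/-! ### Growth exponents and growth tight actions -/

/-- The growth exponent `limsup_{r → ∞} (1 / r) * log #{a ∈ A | d(o, a) ≤ r}` of `A` with respect
to the (extended pseudo-)metric `d`, based at `o`. It is computed in `[-∞, ∞]`, with the honest
cardinality of the ball (which may be `∞`), so that no boundedness or finiteness is presupposed. -/
noncomputable def growthExponent {A : Type*} (d : A → A → ℝ≥0∞) (o : A) : EReal :=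
  limsup (fun r : ℝ =>
    ENNReal.log (({a : A | d o a ≤ ENNReal.ofReal r}.encard : ℕ∞) : ℝ≥0∞) / (r : EReal)) atTop

/-- The pseudo-metric on `G ⧸ N` induced by an action of `G` on `X` with base point `o`:
the distance of two cosets is the infimum of `d(g • o, g' • o)` over representatives `g`, `g'`. -/
noncomputable def quotientEDist {G X : Type*} [Group G] [PseudoEMetricSpace X] [MulAction G X]
    (o : X) (N : Subgroup G) (a b : G ⧸ N) : ℝ≥0∞ :=
  ⨅ (g : G) (g' : G) (_ : (g : G ⧸ N) = a) (_ : (g' : G ⧸ N) = b), edist (g • o) (g' • o)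

/-- The growth exponent of the quotient `G ⧸ N` for an action of `G` on `X` based at `o`.
The growth exponent of `G` itself is that of `G ⧸ {1}`. -/
noncomputable def quotientGrowthExponent {G X : Type*} [Group G] [PseudoEMetricSpace X]
    [MulAction G X] (o : X) (N : Subgroup G) : EReal :=
  growthExponent (quotientEDist o N) ((1 : G) : G ⧸ N)

/-- The isometric action of `G` on `X`, based at `o`, is growth tight: every quotient of `G` by an
infinite normal subgroup has strictly smaller growth exponent than `G`. -/
def IsGrowthTight (G : Type*) {X : Type*} [Group G] [PseudoEMetricSpace X] [MulAction G X]
    [IsIsometricSMul G X] (o : X) : Prop :=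
  ∀ N : Subgroup G, N.Normal → Infinite N →
    quotientGrowthExponent o N < quotientGrowthExponent o (⊥ : Subgroup G)

/-! ### The length metric of a space glued from metric cells -/

section LengthMetric

variable {X J P : Type*} [PseudoEMetricSpace P]

/-- The distance of `x` and `y` inside a common closed cell (`∞` if there is none). Here
`χ j : P → X` is the characteristic map of the cell `j`, all cells being modelled on `P`. -/
noncomputable def cellEDist (χ : J → P → X) (x y : X) : ℝ≥0∞ :=
  ⨅ (j : J) (p : P) (q : P) (_ : χ j p = x) (_ : χ j q = y), edist p q

/-- The induced length metric of a cell complex: the infimum of the lengths of all finite strings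
`x = z 0, z 1, …, z n = y` any two consecutive points of which lie in a common closed cell. -/
noncomputable def lengthEDist (χ : J → P → X) (x y : X) : ℝ≥0∞ :=
  ⨅ (n : ℕ) (z : ℕ → X) (_ : z 0 = x) (_ : z n = y),
    ∑ k ∈ Finset.range n, cellEDist χ (z k) (z (k + 1))

theorem cellEDist_comm (χ : J → P → X) (x y : X) : cellEDist χ x y = cellEDist χ y x := by
  have key : ∀ x y : X, cellEDist χ x y ≤ cellEDist χ y x := by
    intro x y
    refine le_iInf fun j => le_iInf fun p => le_iInf fun q => le_iInf fun hp => le_iInf fun hq => ?_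
    rw [edist_comm]
    exact iInf_le_of_le j <| iInf_le_of_le q <| iInf_le_of_le p <| iInf_le_of_le hq <|
      iInf_le_of_le hp le_rfl
  exact le_antisymm (key x y) (key y x)

theorem lengthEDist_le (χ : J → P → X) {x y : X} (n : ℕ) (z : ℕ → X) (h0 : z 0 = x)
    (hn : z n = y) :
    lengthEDist χ x y ≤ ∑ k ∈ Finset.range n, cellEDist χ (z k) (z (k + 1)) :=
  iInf_le_of_le n <| iInf_le_of_le z <| iInf_le_of_le h0 <| iInf_le_of_le hn le_rfl

theorem lengthEDist_self (χ : J → P → X) (x : X) : lengthEDist χ x x = 0 :=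
  le_antisymm ((lengthEDist_le χ 0 (fun _ => x) rfl rfl).trans (by simp)) bot_le

theorem lengthEDist_comm (χ : J → P → X) (x y : X) :
    lengthEDist χ x y = lengthEDist χ y x := by
  have key : ∀ x y : X, lengthEDist χ x y ≤ lengthEDist χ y x := by
    intro x y
    refine le_iInf fun n => le_iInf fun z => le_iInf fun h0 => le_iInf fun hn => ?_
    refine (lengthEDist_le χ n (fun k => z (n - k)) (by simpa using hn) (by simpa using h0)).trans
      (le_of_eq ?_)
    rw [← Finset.sum_range_reflect]
    refine Finset.sum_congr rfl fun k hk => ?_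
    have hk' : k < n := Finset.mem_range.mp hk
    have e1 : n - (n - 1 - k) = k + 1 := by omega
    have e2 : n - (n - 1 - k + 1) = k := by omega
    simp only [e1, e2]
    exact cellEDist_comm χ _ _
  exact le_antisymm (key x y) (key y x)

theorem lengthEDist_triangle (χ : J → P → X) (x y w : X) :
    lengthEDist χ x w ≤ lengthEDist χ x y + lengthEDist χ y w := by
  have key : ∀ (n : ℕ) (z : ℕ → X) (m : ℕ) (u : ℕ → X), z 0 = x → z n = y → u 0 = y → u m = w →
      lengthEDist χ x w ≤ (∑ k ∈ Finset.range n, cellEDist χ (z k) (z (k + 1))) +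
        ∑ k ∈ Finset.range m, cellEDist χ (u k) (u (k + 1)) := by
    intro n z m u hz0 hzn hu0 hum
    have e1 : ∀ k, k ≤ n → (if k ≤ n then z k else u (k - n)) = z k := fun k hk => if_pos hk
    have e2 : ∀ k, (if n + k ≤ n then z (n + k) else u (n + k - n)) = u k := by
      intro k
      rcases Nat.eq_zero_or_pos k with rfl | hk
      · simp [hzn, hu0]
      · rw [if_neg (by omega), Nat.add_sub_cancel_left]
    refine (lengthEDist_le χ (n + m) (fun k => if k ≤ n then z k else u (k - n))
      (by simpa using hz0) ((e2 m).trans hum)).trans (le_of_eq ?_)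
    rw [Finset.sum_range_add]
    congr 1
    · refine Finset.sum_congr rfl fun k hk => ?_
      have hk' : k < n := Finset.mem_range.mp hk
      simp only [e1 k hk'.le, e1 (k + 1) hk']
    · refine Finset.sum_congr rfl fun k _ => ?_
      have := e2 (k + 1)
      rw [← add_assoc] at this
      simp only [e2 k, this]
  conv_rhs => simp only [lengthEDist, ENNReal.iInf_add, ENNReal.add_iInf]
  simp only [le_iInf_iff]
  intros
  apply key <;> assumption

/-- The length metric of a cell complex as an (extended pseudo-)metric space structure. -/
noncomputable abbrev lengthPseudoEMetricSpace (χ : J → P → X) : PseudoEMetricSpace X where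
  edist := lengthEDist χ
  edist_self := lengthEDist_self χ
  edist_comm := lengthEDist_comm χ
  edist_triangle := lengthEDist_triangle χ

/-- A group that permutes the cells of a complex acts by isometries of the length metric. -/
theorem lengthEDist_smul {G : Type*} [Group G] [MulAction G X] (χ : J → P → X)
    (h : ∀ (g : G) (j : J), ∃ j' : J, ∀ p : P, χ j' p = g • χ j p) (g : G) (x y : X) :
    lengthEDist χ (g • x) (g • y) = lengthEDist χ x y := by
  have cell : ∀ (g : G) (x y : X), cellEDist χ (g • x) (g • y) ≤ cellEDist χ x y := by
    intro g x y
    refine le_iInf fun j => le_iInf fun p => le_iInf fun q => le_iInf fun hp => le_iInf fun hq => ?_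
    obtain ⟨j', hj'⟩ := h g j
    exact iInf_le_of_le j' <| iInf_le_of_le p <| iInf_le_of_le q <|
      iInf_le_of_le (by rw [hj', hp]) <| iInf_le_of_le (by rw [hj', hq]) le_rfl
  have key : ∀ (g : G) (x y : X), lengthEDist χ (g • x) (g • y) ≤ lengthEDist χ x y := by
    intro g x y
    refine le_iInf fun n => le_iInf fun z => le_iInf fun h0 => le_iInf fun hn => ?_
    exact (lengthEDist_le χ n (fun k => g • z k) (by rw [h0]) (by rw [hn])).trans
      (Finset.sum_le_sum fun k _ => cell g _ _)
  refine le_antisymm (key g x y) ?_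
  simpa using key g⁻¹ (g • x) (g • y)

end LengthMetric

/-! ### The Cayley graph as a geodesic space -/

/-- The points of the geometric realization of the Cayley graph of `G` with respect to the family
`s : ι → G`: the vertices `g : G`, and for all `g : G` and `i : ι` the interior points of an edge
from `g` to `g * s i`, parametrized by the open unit interval. -/
inductive CayleyGraph {G ι : Type*} (s : ι → G) : Type _
  | vertex (g : G) : CayleyGraph s
  | inner (g : G) (i : ι) (t : Set.Ioo (0 : ℝ) 1) : CayleyGraph s

namespace CayleyGraph

variable {G ι : Type*} [Group G] (s : ι → G)

/-- The parametrization of the closed edge from `g` to `g * s i` by the unit interval. -/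
noncomputable def edge (e : G × ι) (t : I) : CayleyGraph s :=
  if h0 : (t : ℝ) = 0 then vertex e.1
  else if h1 : (t : ℝ) = 1 then vertex (e.1 * s e.2)
  else inner e.1 e.2 ⟨t, lt_of_le_of_ne t.2.1 (Ne.symm h0), lt_of_le_of_ne t.2.2 h1⟩

/-- The action of `G` on its Cayley graph by left multiplication. -/
instance : MulAction G (CayleyGraph s) where
  smul g x := match x with
    | vertex h => vertex (g * h)
    | inner h i t => inner (g * h) i t
  one_smul x := by
    cases x with
    | vertex h => exact congrArg vertex (one_mul h)
    | inner h i t => exact congrArg (fun k => inner k i t) (one_mul h)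
  mul_smul a b x := by
    cases x with
    | vertex h => exact congrArg vertex (mul_assoc a b h)
    | inner h i t => exact congrArg (fun k => inner k i t) (mul_assoc a b h)

theorem edge_smul (g : G) (e : G × ι) (t : I) :
    edge s ((g * e.1, e.2) : G × ι) t = g • edge s e t := by
  unfold edge
  split_ifs
  · rfl
  · exact congrArg vertex (mul_assoc g e.1 (s e.2))
  · rfl

/-- The metric of the Cayley graph: the length metric in which all edges have length one. -/
noncomputable instance : PseudoEMetricSpace (CayleyGraph s) :=
  lengthPseudoEMetricSpace (edge s)

end CayleyGraph

/-! ### The universal cover of the Salvetti complex of `F × F` -/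

/-- The points of the product of the Cayley graphs of `G₁` and `G₂` with respect to `s₁` and `s₂`.
If `s₁` and `s₂` are free bases, this is the product of two trees that is the universal cover of the
Salvetti complex of the right-angled Artin group `G₁ × G₂` (the defining graph being the join of the
two bases). It is a structure of its own, so as not to carry the sup metric. -/
@[ext]
structure SalvettiCover {G₁ G₂ ι₁ ι₂ : Type*} (s₁ : ι₁ → G₁) (s₂ : ι₂ → G₂) where
  fst : CayleyGraph s₁
  snd : CayleyGraph s₂

namespace SalvettiCover

variable {G₁ G₂ ι₁ ι₂ : Type*} [Group G₁] [Group G₂] (s₁ : ι₁ → G₁) (s₂ : ι₂ → G₂)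

/-- The vertex of the square complex given by an element of `G₁ × G₂`. -/
def vertex (g : G₁ × G₂) : SalvettiCover s₁ s₂ :=
  ⟨CayleyGraph.vertex g.1, CayleyGraph.vertex g.2⟩

/-- The closed square that is the product of two closed edges, parametrized by the unit square with
its Euclidean metric. (As soon as `ι₁` and `ι₂` are nonempty, every point is in such a square.) -/
noncomputable def square (e : (G₁ × ι₁) × (G₂ × ι₂)) (p : WithLp 2 (I × I)) :
    SalvettiCover s₁ s₂ :=
  ⟨CayleyGraph.edge s₁ e.1 p.fst, CayleyGraph.edge s₂ e.2 p.snd⟩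

/-- The coordinatewise action of `G₁ × G₂`. -/
instance : MulAction (G₁ × G₂) (SalvettiCover s₁ s₂) where
  smul g x := ⟨g.1 • x.fst, g.2 • x.snd⟩
  one_smul x := SalvettiCover.ext (one_smul G₁ x.fst) (one_smul G₂ x.snd)
  mul_smul a b x := SalvettiCover.ext (mul_smul a.1 b.1 x.fst) (mul_smul a.2 b.2 x.snd)

/-- The piecewise Euclidean metric: the length metric in which all squares are Euclidean unit
squares. -/
noncomputable instance : PseudoEMetricSpace (SalvettiCover s₁ s₂) :=
  lengthPseudoEMetricSpace (square s₁ s₂)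

instance : IsIsometricSMul (G₁ × G₂) (SalvettiCover s₁ s₂) :=
  ⟨fun g => lengthEDist_smul (square s₁ s₂) (fun g e => by
    exact ⟨((g.1 * e.1.1, e.1.2), (g.2 * e.2.1, e.2.2)), fun p => SalvettiCover.ext
      (CayleyGraph.edge_smul s₁ g.1 e.1 p.fst) (CayleyGraph.edge_smul s₂ g.2 e.2 p.snd)⟩) g⟩

end SalvettiCover

/-- The points of the 1-skeleton of the product square complex: at least one of the two coordinates
is a vertex. -/
@[ext]
structure SalvettiSkeleton {G₁ G₂ ι₁ ι₂ : Type*} (s₁ : ι₁ → G₁) (s₂ : ι₂ → G₂) where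
  point : SalvettiCover s₁ s₂
  mem : (∃ g, point.fst = CayleyGraph.vertex g) ∨ (∃ g, point.snd = CayleyGraph.vertex g)

namespace SalvettiSkeleton

variable {G₁ G₂ ι₁ ι₂ : Type*} [Group G₁] [Group G₂] (s₁ : ι₁ → G₁) (s₂ : ι₂ → G₂)

/-- The vertex of the 1-skeleton given by an element of `G₁ × G₂`. -/
def vertex (g : G₁ × G₂) : SalvettiSkeleton s₁ s₂ :=
  ⟨SalvettiCover.vertex s₁ s₂ g, Or.inl ⟨g.1, rfl⟩⟩

/-- The closed edges of the 1-skeleton, parametrized by the unit interval: each is the product of an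
edge of one of the two Cayley graphs and a vertex of the other one. -/
noncomputable def edge : (G₁ × ι₁) × G₂ ⊕ G₁ × (G₂ × ι₂) → I → SalvettiSkeleton s₁ s₂
  | Sum.inl (e, h), t => ⟨⟨CayleyGraph.edge s₁ e t, CayleyGraph.vertex h⟩, Or.inr ⟨h, rfl⟩⟩
  | Sum.inr (g, e), t => ⟨⟨CayleyGraph.vertex g, CayleyGraph.edge s₂ e t⟩, Or.inl ⟨g, rfl⟩⟩

/-- The coordinatewise action of `G₁ × G₂`. -/
instance : MulAction (G₁ × G₂) (SalvettiSkeleton s₁ s₂) where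
  smul g x := ⟨g • x.point, x.mem.imp
    (fun ⟨h, hh⟩ => ⟨g.1 * h, congrArg (g.1 • ·) hh⟩)
    (fun ⟨h, hh⟩ => ⟨g.2 * h, congrArg (g.2 • ·) hh⟩)⟩
  one_smul x := SalvettiSkeleton.ext (one_smul (G₁ × G₂) x.point)
  mul_smul a b x := SalvettiSkeleton.ext (mul_smul a b x.point)

/-- The 1-skeleton metric: the length metric in which all edges have length one. -/
noncomputable instance : PseudoEMetricSpace (SalvettiSkeleton s₁ s₂) :=
  lengthPseudoEMetricSpace (edge s₁ s₂)

instance : IsIsometricSMul (G₁ × G₂) (SalvettiSkeleton s₁ s₂) :=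
  ⟨fun g => lengthEDist_smul (edge s₁ s₂) (fun g e => by
    rcases e with ⟨e, h⟩ | ⟨h, e⟩
    · exact ⟨Sum.inl ((g.1 * e.1, e.2), g.2 * h), fun t =>
        SalvettiSkeleton.ext (SalvettiCover.ext (CayleyGraph.edge_smul s₁ g.1 e t) rfl)⟩
    · exact ⟨Sum.inr (g.1 * h, (g.2 * e.1, e.2)), fun t =>
        SalvettiSkeleton.ext (SalvettiCover.ext rfl (CayleyGraph.edge_smul s₂ g.2 e t))⟩) g⟩

end SalvettiSkeleton

/-! ### Counting reduced words -/

namespace FreeGroup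

variable {ι : Type*}

/-! Let `n` be the rank of `F` and `h = log (2n - 1)`. Both bases have `n` elements, and `n ≥ 2`
because `F` is not abelian. Spheres of radius `k` in `F` have about `exp (h k)` elements for either
word metric, so pairs with lengths `(i, j)` number about `exp (h (i + j))`, and growth exponents are
found by maximizing linear functions of `(i, j)` over balls.

For the L² metric the maximum of `h (i + j)` on `i² + j² ≤ R²` is `√2 h R`, attained on the
diagonal: both factors are needed for full growth. An infinite normal subgroup `N` contains some
`(x, y) ≠ 1`. As `F` has trivial center, a commutator of `(x, y)` with an element of one factor is a
nontrivial element `w` of `N` in that factor. Deleting copies of `w` from the reduced word of that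
coordinate does not change the coset and lengthens nothing, so cosets have representatives whose
coordinate avoids `w`. Words avoiding `w` grow at a rate `α < h`
(`exists_card_avoidingWords_le_exp`). By Cauchy–Schwarz the quotient has exponent at most `√(α² +
h²) < √2 h`.

For the L¹ metric the maximum of `h (i + j)` on `i + j ≤ R` is `h R`, which one factor attains
alone. Hence the quotient by the other factor has the same growth.

The vertex metrics are computed by explicit paths from above and by 1-Lipschitz functions (`height`)
from below. Every base point is at finite distance from a vertex; replacing it by that vertex
changes displacements by a bounded amount, hence no growth exponent. -/

theorem exists_isReduced_cons [Nonempty ι] {l : List (ι × Bool)} (h : IsReduced l) :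
    ∃ x, IsReduced (x :: l) := by
  cases l with
  | nil => exact ⟨(Classical.arbitrary ι, true), IsReduced.singleton⟩
  | cons y l => exact ⟨y, isReduced_cons_cons.2 ⟨fun _ => rfl, h⟩⟩

variable [DecidableEq ι]

/-- Deleting a subword that represents an element of a normal subgroup does not change the coset:
every coset has an element of minimal norm, and its reduced word avoids that subword. -/
theorem exists_avoiding_representative {N : Subgroup (FreeGroup ι)} (hN : N.Normal)
    {w : FreeGroup ι} (hw : w ∈ N) (hw1 : w ≠ 1) (g : FreeGroup ι) :
    ∃ g' : FreeGroup ι, g⁻¹ * g' ∈ N ∧ g'.norm ≤ g.norm ∧ ¬ w.toWord <:+: g'.toWord := by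
  induction hn : g.norm using Nat.strong_induction_on generalizing g with
  | _ n ih =>
    by_cases h : w.toWord <:+: g.toWord
    · obtain ⟨u, v, huv⟩ := h
      have hg : g = mk u * w * mk v := by
        rw [← mk_toWord (x := g), ← huv, ← mul_mk, ← mul_mk, mk_toWord]
      have hlt : (mk (u ++ v)).norm < n := by
        have h1 : g.norm = u.length + w.toWord.length + v.length := by
          rw [norm, ← huv, List.length_append, List.length_append]
        have h2 : 0 < w.toWord.length :=
          List.length_pos_of_ne_nil fun h => hw1 (toWord_eq_nil_iff.1 h)
        have h3 := norm_mk_le (L₁ := u ++ v)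
        rw [List.length_append] at h3
        omega
      obtain ⟨g', h1, h2, h3⟩ := ih _ hlt _ rfl
      refine ⟨g', ?_, by omega, h3⟩
      -- Deleting `w` from `u w v` multiplies on the right by the conjugate `v⁻¹ w⁻¹ v`, which is in
      -- `N`.
      have : g⁻¹ * g' = ((mk v)⁻¹ * w⁻¹ * (mk v)⁻¹⁻¹) * ((mk (u ++ v))⁻¹ * g') := by
        rw [hg, ← mul_mk]; group
      rw [this]
      exact N.mul_mem (hN.conj_mem _ (N.inv_mem hw) _) h1
    · exact ⟨g, by simp, hn.le, h⟩

variable [Fintype ι]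

/-- The words `l` of length `k` such that `x :: l` is reduced. -/
def reducedWords : ℕ → ι × Bool → Finset (List (ι × Bool))
  | 0, _ => {[]}
  | k + 1, x => (Finset.univ.filter fun y : ι × Bool => x.1 = y.1 → x.2 = y.2).biUnion
      fun y => (reducedWords k y).map ⟨(y :: ·), List.cons_injective⟩

theorem mem_reducedWords {k : ℕ} {x : ι × Bool} {l : List (ι × Bool)} :
    l ∈ reducedWords k x ↔ l.length = k ∧ IsReduced (x :: l) := by
  induction k generalizing x l with
  | zero =>
    simp only [reducedWords, Finset.mem_singleton, List.length_eq_zero_iff]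
    exact ⟨fun h => ⟨h, h ▸ IsReduced.singleton⟩, fun h => h.1⟩
  | succ k ih =>
    simp only [reducedWords, Finset.mem_biUnion, Finset.mem_filter, Finset.mem_univ, true_and,
      Finset.mem_map, Function.Embedding.coeFn_mk]
    constructor
    · rintro ⟨y, hy, l, hl, rfl⟩
      rw [ih] at hl
      exact ⟨by simp [hl.1], isReduced_cons_cons.2 ⟨hy, hl.2⟩⟩
    · rintro ⟨hl, hr⟩
      cases l with
      | nil => simp at hl
      | cons y l =>
        rw [isReduced_cons_cons] at hr
        exact ⟨y, hr.1, l, ih.2 ⟨by simpa using hl, hr.2⟩, rfl⟩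

/-- The inverse of `x` is the only letter excluded. -/
theorem card_filter_not_cancel (x : ι × Bool) :
    (Finset.univ.filter fun y : ι × Bool => x.1 = y.1 → x.2 = y.2).card =
      2 * Fintype.card ι - 1 := by
  have : (Finset.univ.filter fun y : ι × Bool => x.1 = y.1 → x.2 = y.2) =
      Finset.univ.erase (x.1, !x.2) := by
    ext ⟨i, b⟩
    obtain ⟨j, c⟩ := x
    simp only [Finset.mem_filter, Finset.mem_univ, true_and, Finset.mem_erase, ne_eq,
      Prod.mk.injEq, not_and, and_true]
    cases b <;> cases c <;> simp [eq_comm]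
  rw [this, Finset.card_erase_of_mem (Finset.mem_univ _), Finset.card_univ, Fintype.card_prod,
    Fintype.card_bool, mul_comm]

theorem card_reducedWords (k : ℕ) (x : ι × Bool) :
    (reducedWords k x).card = (2 * Fintype.card ι - 1) ^ k := by
  induction k generalizing x with
  | zero => simp [reducedWords]
  | succ k ih =>
    rw [reducedWords, Finset.card_biUnion]
    · simp [ih, card_filter_not_cancel, pow_succ, mul_comm]
    · intro y _ z _ hyz
      rw [Function.onFun, Finset.disjoint_left]
      simp only [Finset.mem_map, Function.Embedding.coeFn_mk, not_exists, not_and]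
      rintro _ ⟨l, -, rfl⟩ m - h
      exact hyz (List.cons_eq_cons.1 h).1.symm

/-- The words `l` of length `k` such that `x :: l` is reduced and `w` is not a subword of `l`. -/
def avoidingWords (w : List (ι × Bool)) (k : ℕ) (x : ι × Bool) : Finset (List (ι × Bool)) :=
  (reducedWords k x).filter fun l => ¬ w <:+: l

/-- Some word `y :: w` can follow `x`, and it is not avoiding. The extra letter `y` is a buffer,
needed when `w` begins with the inverse of `x`; a second generator then supplies it. -/
theorem card_avoidingWords_lt (hι : 1 < Fintype.card ι) {w : List (ι × Bool)} (hw : IsReduced w)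
    (x : ι × Bool) : (avoidingWords w (w.length + 1) x).card <
      (2 * Fintype.card ι - 1) ^ (w.length + 1) := by
  rw [← card_reducedWords _ x]
  obtain ⟨y, hxy, hy⟩ : ∃ y : ι × Bool, (x.1 = y.1 → x.2 = y.2) ∧ IsReduced (y :: w) := by
    cases w with
    | nil => exact ⟨x, fun _ => rfl, IsReduced.singleton⟩
    | cons h w =>
      by_cases hx : x.1 = h.1 → x.2 = h.2
      · exact ⟨x, fun _ => rfl, isReduced_cons_cons.2 ⟨hx, hw⟩⟩
      · have := Fintype.one_lt_card_iff_nontrivial.1 hι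
        obtain ⟨i, hi⟩ := exists_ne x.1
        simp only [Classical.not_imp] at hx
        exact ⟨(i, true), fun h => absurd h.symm hi,
          isReduced_cons_cons.2 ⟨fun h => absurd (h.trans hx.1.symm) hi, hw⟩⟩
  refine Finset.card_lt_card (Finset.filter_ssubset.2 ⟨y :: w, ?_, ?_⟩)
  · exact mem_reducedWords.2 ⟨by simp, isReduced_cons_cons.2 ⟨hxy, hy⟩⟩
  · exact not_not.2 (List.suffix_cons y w).isInfix

/-- Submultiplicativity: cut a word after `L` letters. Both pieces avoid `w`, and the second follows
the last letter of the first, which is why the bounds are uniform in `x`. -/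
theorem card_avoidingWords_add_le {w : List (ι × Bool)} {k L B M : ℕ}
    (hB : ∀ x, (avoidingWords w k x).card ≤ B) (hM : ∀ x, (avoidingWords w L x).card ≤ M)
    (x : ι × Bool) : (avoidingWords w (k + L) x).card ≤ B * M := by
  refine (Finset.card_le_mul_card_image (f := List.take L) _ B ?_).trans
    (Nat.mul_le_mul_left B ((Finset.card_le_card ?_).trans (hM x)))
  · intro u hu
    refine (Finset.card_le_card_of_injOn (List.drop L) ?_ ?_).trans
      (hB ((x :: u).getLast (List.cons_ne_nil _ _)))
    · intro l hl
      simp only [Finset.coe_filter, Set.mem_ofPred_eq, avoidingWords, Finset.mem_filter,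
        mem_reducedWords] at hl
      obtain ⟨⟨⟨hlen, hred⟩, havoid⟩, rfl⟩ := hl
      simp only [avoidingWords, Finset.coe_filter, Set.mem_ofPred_eq, mem_reducedWords]
      refine ⟨⟨by simp [hlen], hred.infix ?_⟩,
        fun h => havoid (h.trans (List.drop_suffix L l).isInfix)⟩
      -- The last letter of `x :: l.take L` followed by `l.drop L` is a suffix of `x :: l`, hence
      -- reduced.
      refine ⟨(x :: l.take L).dropLast, [], ?_⟩
      have h := congrArg (· ++ l.drop L)
        (List.dropLast_append_getLast (List.cons_ne_nil x (l.take L)))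
      simpa using h
    · intro l hl m hm h
      simp only [Finset.coe_filter, Set.mem_ofPred_eq] at hl hm
      rw [← List.take_append_drop L l, ← List.take_append_drop L m, hl.2, hm.2, h]
  · intro u hu
    simp only [Finset.mem_image, avoidingWords, Finset.mem_filter, mem_reducedWords] at hu ⊢
    obtain ⟨l, ⟨⟨hlen, hred⟩, havoid⟩, rfl⟩ := hu
    refine ⟨⟨by simp [hlen], hred.infix ?_⟩,
        fun h => havoid (h.trans (List.take_prefix L l).isInfix)⟩
    exact ⟨[], l.drop L, by simp⟩

theorem card_avoidingWords_le_pow (w : List (ι × Bool)) (k : ℕ) (x : ι × Bool) :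
    (avoidingWords w k x).card ≤ (2 * Fintype.card ι - 1) ^ k :=
  (Finset.card_filter_le _ _).trans (card_reducedWords k x).le

theorem card_avoidingWords_le (hι : 1 < Fintype.card ι) {w : List (ι × Bool)} (hw : IsReduced w)
    (j m : ℕ) (x : ι × Bool) :
    (avoidingWords w (j + m * (w.length + 1)) x).card ≤
      (2 * Fintype.card ι - 1) ^ j * ((2 * Fintype.card ι - 1) ^ (w.length + 1) - 1) ^ m := by
  induction m generalizing x with
  | zero => simpa using card_avoidingWords_le_pow w j x
  | succ m ih =>
    rw [Nat.succ_mul, ← add_assoc, pow_succ, ← mul_assoc]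
    exact card_avoidingWords_add_le ih
      (fun x => Nat.le_sub_one_of_lt (card_avoidingWords_lt hι hw x)) x

/-- The number of reduced words that avoid a given reduced word grows at a rate that is strictly
smaller than that of all reduced words. -/
theorem exists_card_avoidingWords_le_exp (hι : 1 < Fintype.card ι) {w : List (ι × Bool)}
    (hw : IsReduced w) : ∃ α C : ℝ, 0 ≤ α ∧ α < Real.log (2 * Fintype.card ι - 1 : ℕ) ∧ 0 < C ∧
      ∀ k x, ((avoidingWords w k x).card : ℝ) ≤ C * Real.exp (α * k) := by
  set d := 2 * Fintype.card ι - 1 with hd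
  set L := w.length + 1 with hL
  have hd3 : 3 ≤ d := by omega
  have hdL : d ≤ d ^ L := Nat.le_self_pow (by omega) d
  have hd0 : (0 : ℝ) < d := by exact_mod_cast (by omega : 0 < d)
  have hL0 : (0 : ℝ) < L := by exact_mod_cast (by omega : 0 < L)
  set D := d ^ L - 1 with hD
  have hD1 : (1 : ℝ) ≤ D := by exact_mod_cast (by omega : 1 ≤ D)
  have hDlt : (D : ℝ) < (d : ℝ) ^ L := by exact_mod_cast (by omega : D < d ^ L)
  have hlogD : 0 ≤ Real.log D := Real.log_nonneg hD1
  -- Each block of `L` letters contributes a factor of at most `D = d ^ L - 1`, so the rate is `log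
  -- D / L < log d`. The remaining `k % L` letters go into the constant `d ^ L`.
  refine ⟨Real.log D / L, (d : ℝ) ^ L, by positivity, ?_, by positivity, fun k x => ?_⟩
  · rw [div_lt_iff₀ hL0, mul_comm, ← Real.log_pow]
    exact Real.log_lt_log (by linarith) hDlt
  · have key := card_avoidingWords_le hι hw (k % L) (k / L) x
    rw [Nat.mod_add_div'] at key
    calc ((avoidingWords w k x).card : ℝ) ≤ (d : ℝ) ^ (k % L) * (D : ℝ) ^ (k / L) := by
          exact_mod_cast key
      _ ≤ (d : ℝ) ^ L * Real.exp (Real.log D / L * k) := by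
          refine mul_le_mul ?_ ?_ (by positivity) (by positivity)
          · exact pow_le_pow_right₀ (by exact_mod_cast (by omega : 1 ≤ d))
              (Nat.mod_lt _ (by omega)).le
          · rw [← Real.exp_log (by linarith : (0 : ℝ) < D), ← Real.exp_nat_mul, Real.log_exp]
            refine Real.exp_le_exp.2 ?_
            rw [div_mul_eq_mul_div, le_div_iff₀ hL0, mul_right_comm, mul_comm (Real.log _)]
            refine mul_le_mul_of_nonneg_right ?_ hlogD
            exact_mod_cast Nat.div_mul_le_self k L

/-- The elements of norm `k` of a free group whose reduced words avoid a given nontrivial reduced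
word grow at a rate that is strictly smaller than that of the free group. -/
theorem exists_finset_avoiding (hι : 1 < Fintype.card ι) (w : FreeGroup ι) :
    ∃ α C : ℝ, 0 ≤ α ∧ α < Real.log (2 * Fintype.card ι - 1 : ℕ) ∧ 0 < C ∧
      ∀ k : ℕ, ∃ S : Finset (FreeGroup ι),
        (∀ g : FreeGroup ι, ¬ w.toWord <:+: g.toWord → g.norm = k → g ∈ S) ∧
        (S.card : ℝ) ≤ C * Real.exp (α * k) := by
  obtain ⟨α, C, hα0, hα, hC, h⟩ := exists_card_avoidingWords_le_exp hι (isReduced_toWord (x := w))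
  have : Nonempty ι := Fintype.card_pos_iff.1 (by omega)
  -- The factor `Fintype.card (ι × Bool)` pays for the choice of a letter `x` that may precede the
  -- word.
  refine ⟨α, Fintype.card (ι × Bool) * C, hα0, hα, by positivity, fun k => ?_⟩
  refine ⟨(Finset.univ.biUnion fun x => avoidingWords w.toWord k x).image mk, ?_, ?_⟩
  · intro g hg hk
    obtain ⟨x, hx⟩ := exists_isReduced_cons (isReduced_toWord (x := g))
    refine Finset.mem_image.2 ⟨g.toWord, ?_, mk_toWord⟩
    simp only [Finset.mem_biUnion, Finset.mem_univ, true_and, avoidingWords, Finset.mem_filter,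
      mem_reducedWords]
    exact ⟨x, ⟨hk, hx⟩, hg⟩
  · calc _ ≤ ((Finset.univ.biUnion fun x => avoidingWords w.toWord k x).card : ℝ) := by
          exact_mod_cast Finset.card_image_le
      _ ≤ ∑ x : ι × Bool, ((avoidingWords w.toWord k x).card : ℝ) := by
          exact_mod_cast Finset.card_biUnion_le
      _ ≤ ∑ x : ι × Bool, C * Real.exp (α * k) := Finset.sum_le_sum fun x _ => h k x
      _ = _ := by rw [Finset.sum_const, nsmul_eq_mul, Finset.card_univ, mul_assoc]

theorem exists_finset_norm_eq_card_le (hι : 0 < Fintype.card ι) :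
    ∃ C : ℝ, 0 < C ∧ ∀ k : ℕ, ∃ S : Finset (FreeGroup ι), (∀ g : FreeGroup ι, g.norm = k → g ∈ S) ∧
      (S.card : ℝ) ≤ C * Real.exp (Real.log (2 * Fintype.card ι - 1 : ℕ) * k) := by
  have : Nonempty ι := Fintype.card_pos_iff.1 hι
  have hd : (0 : ℝ) < (2 * Fintype.card ι - 1 : ℕ) := by exact_mod_cast (by omega)
  refine ⟨Fintype.card (ι × Bool), by positivity, fun k => ?_⟩
  refine ⟨(Finset.univ.biUnion fun x => reducedWords k x).image mk, ?_, ?_⟩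
  · intro g hk
    obtain ⟨x, hx⟩ := exists_isReduced_cons (isReduced_toWord (x := g))
    refine Finset.mem_image.2 ⟨g.toWord, ?_, mk_toWord⟩
    simp only [Finset.mem_biUnion, Finset.mem_univ, true_and, mem_reducedWords]
    exact ⟨x, hk, hx⟩
  · calc _ ≤ ((Finset.univ.biUnion fun x : ι × Bool => reducedWords k x).card : ℝ) := by
          exact_mod_cast Finset.card_image_le
      _ ≤ ∑ x : ι × Bool, ((reducedWords k x).card : ℝ) := by
          exact_mod_cast Finset.card_biUnion_le
      _ = _ := by
          simp only [card_reducedWords]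
          rw [Finset.sum_const, nsmul_eq_mul, Finset.card_univ, mul_comm (Real.log _),
            Real.exp_nat_mul, Real.exp_log hd, Nat.cast_pow]

theorem exists_finset_norm_eq_le_card (hι : 0 < Fintype.card ι) (k : ℕ) :
    ∃ S : Finset (FreeGroup ι), (∀ g ∈ S, g.norm = k) ∧
      Real.exp (Real.log (2 * Fintype.card ι - 1 : ℕ) * k) ≤ S.card := by
  have : Nonempty ι := Fintype.card_pos_iff.1 hι
  have hd : (0 : ℝ) < (2 * Fintype.card ι - 1 : ℕ) := by exact_mod_cast (by omega)
  -- Fixing one preceding letter loses only a constant factor of the sphere and leaves exactly `(2n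
  -- - 1) ^ k` words.
  set x : ι × Bool := (Classical.arbitrary ι, true)
  have red : ∀ l ∈ reducedWords k x, (mk l).toWord = l := fun l hl => by
    rw [toWord_mk]
    exact ((mem_reducedWords.1 hl).2.infix (List.suffix_cons _ _).isInfix).reduce_eq
  refine ⟨(reducedWords k x).image mk, ?_, ?_⟩
  · intro g hg
    obtain ⟨l, hl, rfl⟩ := Finset.mem_image.1 hg
    rw [norm, red l hl, (mem_reducedWords.1 hl).1]
  · rw [Finset.card_image_of_injOn, card_reducedWords, mul_comm (Real.log _), Real.exp_nat_mul,
      Real.exp_log hd, Nat.cast_pow]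
    intro l hl m hm h
    rw [← red l hl, ← red m hm, h]

end FreeGroup

/-! ### The metric on vertices -/

section LengthMetric

variable {X J P : Type*} [PseudoEMetricSpace P]

theorem lengthEDist_le_edist (χ : J → P → X) (j : J) (p q : P) :
    lengthEDist χ (χ j p) (χ j q) ≤ edist p q := by
  refine (lengthEDist_le χ 1 (fun k => if k = 0 then χ j p else χ j q) rfl rfl).trans ?_
  simp only [Finset.range_one, Finset.sum_singleton]
  exact iInf_le_of_le j <| iInf_le_of_le p <| iInf_le_of_le q <| iInf_le_of_le rfl <|
    iInf_le_of_le rfl le_rfl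

/-- A map that does not increase distances within a cell does not increase the length metric. -/
theorem edist_le_lengthEDist {Y : Type*} [PseudoEMetricSpace Y] (χ : J → P → X) (f : X → Y)
    (hf : ∀ j p q, edist (f (χ j p)) (f (χ j q)) ≤ edist p q) (x y : X) :
    edist (f x) (f y) ≤ lengthEDist χ x y := by
  refine le_iInf fun n => le_iInf fun z => le_iInf fun h0 => le_iInf fun hn => ?_
  subst h0 hn
  refine (edist_le_range_sum_edist (fun k => f (z k)) n).trans
    (Finset.sum_le_sum fun k _ => ?_)
  refine le_iInf fun j => le_iInf fun p => le_iInf fun q => le_iInf fun hp => le_iInf fun hq => ?_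
  rw [← hp, ← hq]
  exact hf j p q

end LengthMetric

theorem WithLp.edist_eq_ofReal_sqrt {α β : Type*} [PseudoEMetricSpace α] [PseudoEMetricSpace β]
    {x y : WithLp 2 (α × β)} {a b : ℝ} (ha : 0 ≤ a) (hb : 0 ≤ b)
    (h1 : edist x.fst y.fst = ENNReal.ofReal a) (h2 : edist x.snd y.snd = ENNReal.ofReal b) :
    edist x y = ENNReal.ofReal (Real.sqrt (a ^ 2 + b ^ 2)) := by
  rw [WithLp.prod_edist_eq_add (by norm_num), h1, h2, ENNReal.toReal_ofNat,
    ENNReal.ofReal_rpow_of_nonneg ha (by norm_num), ENNReal.ofReal_rpow_of_nonneg hb (by norm_num),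
    ← ENNReal.ofReal_add (by positivity) (by positivity),
    ENNReal.ofReal_rpow_of_nonneg (by positivity) (by norm_num), Real.sqrt_eq_rpow,
    Real.rpow_two, Real.rpow_two]

theorem WithLp.edist_le_edist_of_L2 {α β γ δ : Type*} [PseudoEMetricSpace α]
    [PseudoEMetricSpace β] [PseudoEMetricSpace γ] [PseudoEMetricSpace δ]
    {x y : WithLp 2 (α × β)} {z w : WithLp 2 (γ × δ)} (h1 : edist x.fst y.fst ≤ edist z.fst w.fst)
    (h2 : edist x.snd y.snd ≤ edist z.snd w.snd) : edist x y ≤ edist z w := by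
  rw [WithLp.prod_edist_eq_add (by norm_num), WithLp.prod_edist_eq_add (by norm_num)]
  gcongr

/-! ### Paths and height functions in the Cayley tree. -/

namespace CayleyGraph

section Edge

variable {G ι : Type*} [Group G] (s : ι → G)

theorem edge_zero (e : G × ι) : edge s e 0 = vertex e.1 := by simp [edge]

theorem edge_one (e : G × ι) : edge s e 1 = vertex (e.1 * s e.2) := by simp [edge]

theorem exists_edge_eq [Nonempty ι] (x : CayleyGraph s) : ∃ e t, edge s e t = x := by
  cases x with
  | vertex g => exact ⟨(g, Classical.arbitrary ι), 0, edge_zero s _⟩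
  | inner g i t =>
    refine ⟨(g, i), ⟨t, t.2.1.le, t.2.2.le⟩, ?_⟩
    simp [edge, t.2.1.ne', t.2.2.ne]

/-- A path in a Cayley graph that runs through `n` edges at unit speed. -/
def IsUnitSpeedPath (γ : ℝ → CayleyGraph s) (n : ℕ) : Prop :=
  ∀ k < n, ∃ e : G × ι, ∀ u ∈ Set.Icc (k : ℝ) (k + 1), ∀ v ∈ Set.Icc (k : ℝ) (k + 1),
    ∃ p q : I, edge s e p = γ u ∧ edge s e q = γ v ∧ edist p q = ENNReal.ofReal |u - v|

variable {s}

/-- The isometry `τ` allows the last edge to be run backwards, as an inverse letter requires. -/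
theorem IsUnitSpeedPath.concat {γ : ℝ → CayleyGraph s} {n : ℕ} (hγ : IsUnitSpeedPath s γ n)
    (e : G × ι) (τ : I → I) (hτ : Isometry τ) (h : edge s e (τ 0) = γ n) :
    IsUnitSpeedPath s (fun u => if u ≤ n then γ u else
      edge s e (τ (Set.projIcc 0 1 zero_le_one (u - n)))) (n + 1) := by
  intro k hk
  rcases Nat.lt_succ_iff_lt_or_eq.1 hk with hk | rfl
  · obtain ⟨e', he'⟩ := hγ k hk
    refine ⟨e', fun u hu v hv => ?_⟩
    have hkn : (k : ℝ) + 1 ≤ n := by exact_mod_cast hk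
    simpa [hu.2.trans hkn, hv.2.trans hkn] using he' u hu v hv
  -- At `u = k` the two branches agree by `h`, so the formula of the new edge holds on the whole
  -- closed interval.
  · have key : ∀ u ∈ Set.Icc (k : ℝ) (k + 1), edge s e (τ (Set.projIcc 0 1 zero_le_one (u - k))) =
        if u ≤ k then γ u else edge s e (τ (Set.projIcc 0 1 zero_le_one (u - k))) := by
      intro u hu
      split_ifs with h'
      · obtain rfl : u = k := le_antisymm h' hu.1
        rw [← h, sub_self, Set.projIcc_left]; rfl
      · rfl
    refine ⟨e, fun u hu v hv => ⟨_, _, key u hu, key v hv, ?_⟩⟩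
    rw [hτ.edist_eq, Set.projIcc_of_mem zero_le_one ⟨by linarith [hu.1], by linarith [hu.2]⟩,
      Set.projIcc_of_mem zero_le_one ⟨by linarith [hv.1], by linarith [hv.2]⟩,
      Subtype.edist_eq, edist_dist, Real.dist_eq, sub_sub_sub_cancel_right]

/-- Subdivision of a path through `m` edges into `max m 1 * n` steps of equal length, each of which
stays within one edge. -/
theorem IsUnitSpeedPath.exists_step [Nonempty ι] {γ : ℝ → CayleyGraph s} {m : ℕ}
    (hγ : IsUnitSpeedPath s γ m) {n : ℕ} {l : ℕ} (hl : l < max m 1 * n) :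
    ∃ (e : G × ι) (p q : I), edge s e p = γ (m * (l / (max m 1 * n : ℕ))) ∧
      edge s e q = γ (m * ((l + 1 : ℕ) / (max m 1 * n : ℕ))) ∧
      edist p q = ENNReal.ofReal (m / (max m 1 * n : ℕ)) := by
  rcases Nat.eq_zero_or_pos m with rfl | hm
  -- A path without edges is subdivided into constant steps; `max m 1` keeps their number positive
  -- for a positive `n`.
  · obtain ⟨e, t, h⟩ := exists_edge_eq s (γ 0)
    exact ⟨e, t, t, by simpa using h, by simpa using h, by simp⟩
  · rw [max_eq_left hm] at hl ⊢
    have hn : 0 < n := Nat.pos_of_ne_zero fun h => by simp [h] at hl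
    have hn' : (0 : ℝ) < n := by exact_mod_cast hn
    have hm' : (0 : ℝ) < m := by exact_mod_cast hm
    -- Step `l` runs from time `l / n` to `(l + 1) / n`, within the edge whose number is the integer
    -- part of `l / n`.
    have hk : l / n < m := (Nat.div_lt_iff_lt_mul hn).2 hl
    have hu : ∀ a : ℕ, (m : ℝ) * (a / (m * n : ℕ)) = a / n := fun a => by
      push_cast; field_simp
    have h1 : ((l / n : ℕ) : ℝ) ≤ l / n := Nat.cast_div_le
    have h2 : ((l + 1 : ℕ) : ℝ) / n ≤ (l / n : ℕ) + 1 := by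
      rw [div_le_iff₀ hn']
      exact_mod_cast Nat.succ_le_of_lt (Nat.lt_div_mul_add hn |>.trans_eq (by ring))
    have h3 : (l : ℝ) / n ≤ ((l + 1 : ℕ) : ℝ) / n := by gcongr; exact Nat.le_succ l
    obtain ⟨e, he⟩ := hγ _ hk
    obtain ⟨p, q, hp, hq, hpq⟩ := he (l / n) ⟨h1, h3.trans h2⟩ ((l + 1 : ℕ) / n) ⟨h1.trans h3, h2⟩
    refine ⟨e, p, q, by rw [hp, hu], by rw [hq, hu], ?_⟩
    rw [hpq]
    congr 1
    rw [abs_sub_comm, abs_of_nonneg (sub_nonneg.2 h3)]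
    push_cast
    field_simp
    ring

theorem IsUnitSpeedPath.edist_le {γ : ℝ → CayleyGraph s} {m : ℕ} (hγ : IsUnitSpeedPath s γ m) :
    edist (γ 0) (γ m) ≤ m := by
  have := edist_le_range_sum_edist (fun k : ℕ => γ k) m
  rw [Nat.cast_zero] at this
  refine this.trans ((Finset.sum_le_sum (g := fun _ => 1) fun k hk => ?_).trans (by simp))
  obtain ⟨e, he⟩ := hγ k (Finset.mem_range.1 hk)
  obtain ⟨p, q, hp, hq, hpq⟩ := he k (by simp) (k + 1 : ℕ) (by simp)
  rw [← hp, ← hq]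
  exact (lengthEDist_le_edist (edge s) e p q).trans (by simp [hpq])

end Edge

variable {F ι : Type*} [Group F] [DecidableEq ι] (b : FreeGroupBasis ι F)

theorem exists_isUnitSpeedPath (g h : F) : ∃ γ : ℝ → CayleyGraph b, γ 0 = vertex g ∧
    γ (b.repr (g⁻¹ * h)).norm = vertex h ∧ IsUnitSpeedPath b γ (b.repr (g⁻¹ * h)).norm := by
  have key : ∀ w : List (ι × Bool), ∃ γ : ℝ → CayleyGraph b, γ 0 = vertex g ∧
      γ w.length = vertex (g * b.repr.symm (FreeGroup.mk w)) ∧ IsUnitSpeedPath b γ w.length := by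
    intro w
    induction w using List.reverseRecOn with
    | nil =>
      refine ⟨fun _ => vertex g, rfl, ?_, fun k hk => absurd hk (Nat.not_lt_zero k)⟩
      rw [← FreeGroup.one_eq_mk, map_one, mul_one]
    | append_singleton w a ih =>
      obtain ⟨γ, h0, h1, hγ⟩ := ih
      have step : ∃ (e : F × ι) (τ : I → I), Isometry τ ∧ edge b e (τ 0) = γ w.length ∧
          edge b e (τ 1) = vertex (g * b.repr.symm (FreeGroup.mk (w ++ [a]))) := by
        rw [h1, ← FreeGroup.mul_mk, map_mul, ← mul_assoc]
        obtain ⟨i, c⟩ := a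
        cases c with
        | true => exact ⟨(_, i), id, isometry_id, edge_zero _ _, edge_one _ _⟩
        | false =>
          -- For an inverse letter the edge starts at the new vertex and is traversed backwards.
          refine ⟨(g * b.repr.symm (FreeGroup.mk w) * b.repr.symm (FreeGroup.mk [(i, false)]), i),
            unitInterval.symm, ?_, ?_, ?_⟩
          · refine Isometry.of_dist_eq fun x y => ?_
            rw [Subtype.dist_eq, Subtype.dist_eq, unitInterval.coe_symm_eq,
              unitInterval.coe_symm_eq, dist_sub_left]
          · rw [unitInterval.symm_zero, edge_one, mul_assoc _ _ (b i)]
            have : b i = b.repr.symm (FreeGroup.mk [(i, true)]) := rfl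
            rw [this, ← map_mul, FreeGroup.mul_mk]
            have : FreeGroup.mk ([(i, false)] ++ [(i, true)]) = 1 := by
              rw [← FreeGroup.mul_mk]
              exact inv_mul_cancel (FreeGroup.of i)
            rw [this, map_one, mul_one]
          · rw [unitInterval.symm_one, edge_zero]
      obtain ⟨e, τ, hτ, h2, h3⟩ := step
      refine ⟨_, ?_, ?_, by simpa using hγ.concat e τ hτ h2⟩
      · simp [h0]
      · simp [h3]
  obtain ⟨γ, h0, h1, hγ⟩ := key (b.repr (g⁻¹ * h)).toWord
  refine ⟨γ, h0, ?_, hγ⟩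
  rw [FreeGroup.norm, h1, FreeGroup.mk_toWord]
  simp

/-- The word length from `g`, extended to the Cayley graph by affine interpolation on edges. -/
noncomputable def height (g : F) : CayleyGraph b → ℝ
  | vertex h => (b.repr (g⁻¹ * h)).norm
  | inner h i t => (1 - t) * (b.repr (g⁻¹ * h)).norm + t * (b.repr (g⁻¹ * (h * b i))).norm

theorem height_edge (g : F) (e : F × ι) (t : I) : height b g (edge b e t) =
    (1 - t) * (b.repr (g⁻¹ * e.1)).norm + t * (b.repr (g⁻¹ * (e.1 * b e.2))).norm := by
  unfold edge
  split_ifs with h0 h1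
  · simp [height, h0]
  · simp [height, h1]
  · rfl

/-- Multiplying by a generator changes the word length by at most one, so the affine interpolation
has slope at most one. -/
theorem edist_height_edge_le (g : F) (e : F × ι) (p q : I) :
    edist (height b g (edge b e p)) (height b g (edge b e q)) ≤ edist p q := by
  rw [Subtype.edist_eq, edist_dist, edist_dist]
  refine ENNReal.ofReal_le_ofReal ?_
  rw [Real.dist_eq, Real.dist_eq, height_edge, height_edge]
  set A := (b.repr (g⁻¹ * e.1)).norm
  set B := (b.repr (g⁻¹ * (e.1 * b e.2))).norm
  have hB : B ≤ A + 1 := by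
    have := FreeGroup.norm_mul_le (b.repr (g⁻¹ * e.1)) (FreeGroup.of e.2)
    rwa [FreeGroup.norm_of, ← b.repr_apply_coe, ← map_mul, mul_assoc] at this
  have hA : A ≤ B + 1 := by
    have := FreeGroup.norm_mul_le (b.repr (g⁻¹ * (e.1 * b e.2))) (FreeGroup.of e.2)⁻¹
    rw [FreeGroup.norm_inv_eq, FreeGroup.norm_of, ← b.repr_apply_coe, ← map_inv, ← map_mul,
      mul_assoc, mul_inv_cancel_right] at this
    exact this
  have hAB : |(A : ℝ) - B| ≤ 1 := by
    have hB' : (B : ℝ) ≤ A + 1 := by exact_mod_cast hB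
    have hA' : (A : ℝ) ≤ B + 1 := by exact_mod_cast hA
    exact abs_le.2 ⟨by linarith, by linarith⟩
  have : (1 - (p : ℝ)) * A + p * B - ((1 - q) * A + q * B) = (q - p) * (A - B) := by ring
  rw [this, abs_mul, abs_sub_comm]
  exact mul_le_of_le_one_right (abs_nonneg _) hAB

theorem height_self (g : F) : height b g (vertex g) = 0 := by simp [height]

theorem edist_height_vertex (g h : F) : edist (height b g (vertex g)) (height b g (vertex h)) =
    ENNReal.ofReal (b.repr (g⁻¹ * h)).norm := by
  rw [height_self, edist_comm, edist_zero_right, height, Real.enorm_of_nonneg (Nat.cast_nonneg _)]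

/-- The distance of two vertices in the Cayley graph of a free group is the word metric. -/
theorem edist_vertex (g h : F) : edist (vertex (s := b) g) (vertex h) =
    ENNReal.ofReal (b.repr (g⁻¹ * h)).norm := by
  apply le_antisymm
  · obtain ⟨γ, h0, h1, hγ⟩ := exists_isUnitSpeedPath b g h
    have := hγ.edist_le
    rwa [h0, h1, ← ENNReal.ofReal_natCast] at this
  · rw [← edist_height_vertex]
    exact edist_le_lengthEDist (edge b) (height b g) (edist_height_edge_le b g) _ _

end CayleyGraph

/-! ### The L² metric on the vertices of the square complex. -/

namespace SalvettiCover

variable {F₁ F₂ ι₁ ι₂ : Type*} [Group F₁] [Group F₂]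

/-- From above: run both tree geodesics simultaneously at proportional speeds, in steps that are
straight segments of squares. From below: the pair of heights maps every square to the Euclidean
plane without increasing distances. -/
theorem edist_vertex [DecidableEq ι₁] [DecidableEq ι₂] [Nonempty ι₁] [Nonempty ι₂]
    (b₁ : FreeGroupBasis ι₁ F₁) (b₂ : FreeGroupBasis ι₂ F₂) (g h : F₁ × F₂) :
    edist (vertex b₁ b₂ g) (vertex b₁ b₂ h) = ENNReal.ofReal (Real.sqrt
      ((b₁.repr (g.1⁻¹ * h.1)).norm ^ 2 + (b₂.repr (g.2⁻¹ * h.2)).norm ^ 2)) := by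
  apply le_antisymm
  · obtain ⟨γ₁, h0, h1, hγ₁⟩ := CayleyGraph.exists_isUnitSpeedPath b₁ g.1 h.1
    obtain ⟨γ₂, h0', h1', hγ₂⟩ := CayleyGraph.exists_isUnitSpeedPath b₂ g.2 h.2
    set m := (b₁.repr (g.1⁻¹ * h.1)).norm
    set n := (b₂.repr (g.2⁻¹ * h.2)).norm
    -- A common subdivision of both paths, so that each step stays in one edge of each tree and
    -- hence in one square.
    set K := max m 1 * max n 1 with hK
    have hK0 : (0 : ℝ) < K := by exact_mod_cast (by positivity : 0 < K)
    have e0 : (⟨γ₁ (m * ((0 : ℕ) / K)), γ₂ (n * ((0 : ℕ) / K))⟩ : SalvettiCover b₁ b₂) =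
        vertex b₁ b₂ g := by
      simp [h0, h0', vertex]
    have e1 : (⟨γ₁ (m * (K / K)), γ₂ (n * (K / K))⟩ : SalvettiCover b₁ b₂) =
        vertex b₁ b₂ h := by
      simp [h1, h1', vertex, div_self hK0.ne']
    rw [← e0, ← e1]
    refine (edist_le_range_sum_edist (fun l : ℕ =>
      (⟨γ₁ (m * (l / K)), γ₂ (n * (l / K))⟩ : SalvettiCover b₁ b₂)) K).trans ?_
    refine (Finset.sum_le_sum (g := fun _ => ENNReal.ofReal
      (Real.sqrt ((m / K : ℝ) ^ 2 + (n / K : ℝ) ^ 2))) fun l hl => ?_).trans (le_of_eq ?_)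
    · obtain ⟨e, p, q, hp, hq, hpq⟩ := hγ₁.exists_step (n := max n 1) (Finset.mem_range.1 hl)
      obtain ⟨e', p', q', hp', hq', hpq'⟩ := hγ₂.exists_step (n := max m 1) (l := l)
        ((Finset.mem_range.1 hl).trans_eq (mul_comm _ _))
      rw [mul_comm (max n 1) (max m 1)] at hp' hq' hpq'
      rw [← hK] at hp hq hpq hp' hq' hpq'
      rw [← hp, ← hq, ← hp', ← hq']
      exact (lengthEDist_le_edist (square b₁ b₂) (e, e') (WithLp.toLp 2 (p, p'))
        (WithLp.toLp 2 (q, q'))).trans_eq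
          (WithLp.edist_eq_ofReal_sqrt (by positivity) (by positivity) hpq hpq')
    · rw [Finset.sum_const, Finset.card_range, nsmul_eq_mul, ← ENNReal.ofReal_natCast,
        ← ENNReal.ofReal_mul hK0.le]
      congr 1
      rw [div_pow, div_pow, ← add_div, Real.sqrt_div (by positivity), Real.sqrt_sq hK0.le,
        mul_div_cancel₀ _ hK0.ne']
  · let f : SalvettiCover b₁ b₂ → WithLp 2 (ℝ × ℝ) := fun x =>
      WithLp.toLp 2 (CayleyGraph.height b₁ g.1 x.fst, CayleyGraph.height b₂ g.2 x.snd)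
    have hf : ∀ e p q, edist (f (square b₁ b₂ e p)) (f (square b₁ b₂ e q)) ≤ edist p q :=
      fun e p q => WithLp.edist_le_edist_of_L2
        (CayleyGraph.edist_height_edge_le b₁ g.1 e.1 p.fst q.fst)
        (CayleyGraph.edist_height_edge_le b₂ g.2 e.2 p.snd q.snd)
    have hd : edist (f (vertex b₁ b₂ g)) (f (vertex b₁ b₂ h)) = ENNReal.ofReal (Real.sqrt
        ((b₁.repr (g.1⁻¹ * h.1)).norm ^ 2 + (b₂.repr (g.2⁻¹ * h.2)).norm ^ 2)) :=
      WithLp.edist_eq_ofReal_sqrt (Nat.cast_nonneg _) (Nat.cast_nonneg _)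
        (CayleyGraph.edist_height_vertex b₁ g.1 h.1) (CayleyGraph.edist_height_vertex b₂ g.2 h.2)
    rw [← hd]
    exact edist_le_lengthEDist (square b₁ b₂) f hf _ _

theorem square_zero (s₁ : ι₁ → F₁) (s₂ : ι₂ → F₂) (e : (F₁ × ι₁) × (F₂ × ι₂)) :
    square s₁ s₂ e (WithLp.toLp 2 (0, 0)) = vertex s₁ s₂ (e.1.1, e.2.1) :=
  SalvettiCover.ext (CayleyGraph.edge_zero s₁ e.1) (CayleyGraph.edge_zero s₂ e.2)

theorem exists_edist_vertex_ne_top [Nonempty ι₁] [Nonempty ι₂] {s₁ : ι₁ → F₁} {s₂ : ι₂ → F₂}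
    (o : SalvettiCover s₁ s₂) : ∃ g, edist o (vertex s₁ s₂ g) ≠ ⊤ := by
  obtain ⟨x, y⟩ := o
  obtain ⟨e, t, rfl⟩ := CayleyGraph.exists_edge_eq s₁ x
  obtain ⟨e', t', rfl⟩ := CayleyGraph.exists_edge_eq s₂ y
  refine ⟨(e.1, e'.1), ?_⟩
  rw [← square_zero s₁ s₂ (e, e')]
  refine ne_top_of_le_ne_top ?_ (lengthEDist_le_edist (square s₁ s₂) (e, e')
    (WithLp.toLp 2 (t, t')) (WithLp.toLp 2 (0, 0)))
  rw [WithLp.edist_eq_ofReal_sqrt dist_nonneg dist_nonneg (edist_dist _ _) (edist_dist _ _)]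
  exact ENNReal.ofReal_ne_top

end SalvettiCover

/-! ### The L¹ metric on the vertices of the 1-skeleton. -/

namespace SalvettiSkeleton

variable {F₁ F₂ ι₁ ι₂ : Type*} [Group F₁] [Group F₂]

theorem edist_vertex_le (s₁ : ι₁ → F₁) (s₂ : ι₂ → F₂) (g h : F₁ × F₂) :
    edist (vertex s₁ s₂ g) (vertex s₁ s₂ h) ≤
      edist (CayleyGraph.vertex (s := s₁) g.1) (CayleyGraph.vertex h.1) +
        edist (CayleyGraph.vertex (s := s₂) g.2) (CayleyGraph.vertex h.2) := by
  refine (edist_triangle _ (vertex s₁ s₂ (h.1, g.2)) _).trans (add_le_add ?_ ?_)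
  · exact edist_le_lengthEDist (CayleyGraph.edge s₁)
      (fun x => (⟨⟨x, CayleyGraph.vertex g.2⟩, Or.inr ⟨g.2, rfl⟩⟩ : SalvettiSkeleton s₁ s₂))
      (fun e p q => lengthEDist_le_edist (edge s₁ s₂) (Sum.inl (e, g.2)) p q) _ _
  · exact edist_le_lengthEDist (CayleyGraph.edge s₂)
      (fun x => (⟨⟨CayleyGraph.vertex h.1, x⟩, Or.inl ⟨h.1, rfl⟩⟩ : SalvettiSkeleton s₁ s₂))
      (fun e p q => lengthEDist_le_edist (edge s₁ s₂) (Sum.inr (h.1, e)) p q) _ _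

/-- The lower bound uses the sum of the two heights: along an edge only one summand varies, so the
sum is 1-Lipschitz there. -/
theorem edist_vertex [DecidableEq ι₁] [DecidableEq ι₂]
    (b₁ : FreeGroupBasis ι₁ F₁) (b₂ : FreeGroupBasis ι₂ F₂) (g h : F₁ × F₂) :
    edist (vertex b₁ b₂ g) (vertex b₁ b₂ h) = ENNReal.ofReal
      ((b₁.repr (g.1⁻¹ * h.1)).norm + (b₂.repr (g.2⁻¹ * h.2)).norm) := by
  apply le_antisymm
  · refine (edist_vertex_le _ _ g h).trans_eq ?_
    rw [CayleyGraph.edist_vertex, CayleyGraph.edist_vertex,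
      ENNReal.ofReal_add (Nat.cast_nonneg _) (Nat.cast_nonneg _)]
  · refine le_trans (le_of_eq ?_) (edist_le_lengthEDist (edge b₁ b₂)
      (fun x : SalvettiSkeleton b₁ b₂ => CayleyGraph.height b₁ g.1 x.point.fst +
        CayleyGraph.height b₂ g.2 x.point.snd) ?_ (vertex b₁ b₂ g) (vertex b₁ b₂ h))
    · simp only [vertex, SalvettiCover.vertex]
      rw [CayleyGraph.height_self, CayleyGraph.height_self, add_zero, edist_comm,
        edist_zero_right]
      exact (Real.enorm_of_nonneg (add_nonneg (Nat.cast_nonneg _) (Nat.cast_nonneg _))).symm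
    · rintro (⟨e, k⟩ | ⟨k, e⟩) p q
      · simp only [edge]
        rw [edist_add_right]
        exact CayleyGraph.edist_height_edge_le b₁ g.1 e p q
      · simp only [edge]
        rw [edist_add_left]
        exact CayleyGraph.edist_height_edge_le b₂ g.2 e p q

theorem edge_inl_zero (s₁ : ι₁ → F₁) (s₂ : ι₂ → F₂) (e : F₁ × ι₁) (k : F₂) :
    edge s₁ s₂ (Sum.inl (e, k)) 0 = vertex s₁ s₂ (e.1, k) :=
  SalvettiSkeleton.ext (SalvettiCover.ext (CayleyGraph.edge_zero s₁ e) rfl)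

theorem edge_inr_zero (s₁ : ι₁ → F₁) (s₂ : ι₂ → F₂) (k : F₁) (e : F₂ × ι₂) :
    edge s₁ s₂ (Sum.inr (k, e)) 0 = vertex s₁ s₂ (k, e.1) :=
  SalvettiSkeleton.ext (SalvettiCover.ext rfl (CayleyGraph.edge_zero s₂ e))

theorem exists_edist_vertex_ne_top [Nonempty ι₁] [Nonempty ι₂] {s₁ : ι₁ → F₁} {s₂ : ι₂ → F₂}
    (o : SalvettiSkeleton s₁ s₂) : ∃ g, edist o (vertex s₁ s₂ g) ≠ ⊤ := by
  have key : ∀ j t, ∃ g, edist (edge s₁ s₂ j t) (vertex s₁ s₂ g) ≠ ⊤ := by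
    intro j t
    have h := ne_top_of_le_ne_top (edist_ne_top t 0) (lengthEDist_le_edist (edge s₁ s₂) j t 0)
    rcases j with ⟨e, k⟩ | ⟨k, e⟩
    · refine ⟨(e.1, k), ?_⟩
      rwa [edge_inl_zero] at h
    · refine ⟨(k, e.1), ?_⟩
      rwa [edge_inr_zero] at h
  obtain ⟨⟨x, y⟩, h⟩ := o
  have h' : (∃ k, x = CayleyGraph.vertex k) ∨ ∃ k, y = CayleyGraph.vertex k := h
  obtain ⟨k, rfl⟩ | ⟨k, rfl⟩ := h'
  · obtain ⟨e, t, rfl⟩ := CayleyGraph.exists_edge_eq s₂ y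
    exact key (Sum.inr (k, e)) t
  · obtain ⟨e, t, rfl⟩ := CayleyGraph.exists_edge_eq s₁ x
    exact key (Sum.inl (e, k)) t

end SalvettiSkeleton

/-! ### Bounds for growth exponents -/

theorem growthExponent_le {A : Type*} {d : A → A → ℝ≥0∞} {o : A} {c C K : ℝ} (hC : 0 < C)
    (h : ∀ r : ℝ, 0 < r → (({a : A | d o a ≤ ENNReal.ofReal r}.encard : ℕ∞) : ℝ≥0∞) ≤
      ENNReal.ofReal (C * (r + K) ^ 2 * Real.exp (c * r))) :
    growthExponent d o ≤ c := by
  have hlim : Tendsto (fun r : ℝ => Real.log (C * (r + K) ^ 2 * Real.exp (c * r)) / r) atTop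
      (nhds c) := by
    have h1 : Tendsto (fun r : ℝ => r + K) atTop atTop := tendsto_atTop_add_const_right _ _ tendsto_id
    have h2 : Tendsto (fun r : ℝ => Real.log (r + K) / (r + K)) atTop (nhds 0) := by
      have := Real.isLittleO_log_id_atTop.tendsto_div_nhds_zero.comp h1
      simpa [Function.comp_def] using this
    -- Expand the logarithm and write `log (r + K) / r` as `(1 + K / r) * (log (r + K) / (r + K))`.
    have h3 : Tendsto (fun r : ℝ => (Real.log C + 2 * K * (Real.log (r + K) / (r + K))) * r⁻¹ +
        2 * (Real.log (r + K) / (r + K)) + c) atTop (nhds ((Real.log C + 2 * K * 0) * 0 + 2 * 0 + c)) :=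
      (((h2.const_mul _).const_add _ |>.mul tendsto_inv_atTop_zero).add (h2.const_mul _)).add_const _
    simp only [mul_zero, zero_add, add_zero] at h3
    refine h3.congr' ?_
    filter_upwards [eventually_gt_atTop 0, eventually_gt_atTop (-K)] with r hr hrK
    have : 0 < r + K := by linarith
    rw [Real.log_mul (by positivity) (by positivity), Real.log_mul (by positivity) (by positivity),
      Real.log_exp, Real.log_pow]
    field_simp
    push_cast
    ring
  have hlim' : Tendsto (fun r : ℝ => ((Real.log (C * (r + K) ^ 2 * Real.exp (c * r)) / r : ℝ) :
      EReal)) atTop (nhds (c : EReal)) := EReal.tendsto_coe.2 hlim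
  rw [growthExponent, ← hlim'.limsup_eq]
  refine limsup_le_limsup ?_
  filter_upwards [eventually_gt_atTop 0, eventually_gt_atTop (-K)] with r hr hrK
  have : 0 < r + K := by linarith
  rw [EReal.coe_div, ← ENNReal.log_ofReal_of_pos (by positivity)]
  exact EReal.div_le_div_right_of_nonneg (by exact_mod_cast hr.le) (ENNReal.log_monotone (h r hr))

theorem le_growthExponent {A : Type*} {d : A → A → ℝ≥0∞} {o : A} {c C r₀ : ℝ} (hC : 0 < C)
    (h : ∀ r : ℝ, r₀ ≤ r → ENNReal.ofReal (C * Real.exp (c * r)) ≤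
      (({a : A | d o a ≤ ENNReal.ofReal r}.encard : ℕ∞) : ℝ≥0∞)) :
    c ≤ growthExponent d o := by
  have hlim : Tendsto (fun r : ℝ => Real.log (C * Real.exp (c * r)) / r) atTop (nhds c) := by
    have h3 : Tendsto (fun r : ℝ => Real.log C * r⁻¹ + c) atTop (nhds (Real.log C * 0 + c)) :=
      (tendsto_inv_atTop_zero.const_mul _).add_const _
    rw [mul_zero, zero_add] at h3
    refine h3.congr' ?_
    filter_upwards [eventually_gt_atTop 0] with r hr
    rw [Real.log_mul (by positivity) (by positivity), Real.log_exp]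
    field_simp
  have hlim' : Tendsto (fun r : ℝ => ((Real.log (C * Real.exp (c * r)) / r : ℝ) :
      EReal)) atTop (nhds (c : EReal)) := EReal.tendsto_coe.2 hlim
  rw [growthExponent, ← hlim'.limsup_eq]
  refine limsup_le_limsup ?_
  filter_upwards [eventually_gt_atTop 0, eventually_ge_atTop r₀] with r hr hr0
  rw [EReal.coe_div, ← ENNReal.log_ofReal_of_pos (by positivity)]
  exact EReal.div_le_div_right_of_nonneg (by exact_mod_cast hr.le) (ENNReal.log_monotone (h r hr0))

/-! ### Change of base point and choice of coset representatives. -/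

section Action

variable {G X : Type*} [Group G] [PseudoEMetricSpace X] [MulAction G X] [IsIsometricSMul G X]
  {o v : X} {N : Subgroup G} {c C : ℝ}

theorem edist_smul_le_add (o v : X) (g : G) :
    edist o (g • o) ≤ edist v (g • v) + 2 * edist o v := by
  calc edist o (g • o) ≤ edist o v + edist v (g • v) + edist (g • v) (g • o) :=
        edist_triangle4 _ _ _ _
    _ = edist v (g • v) + 2 * edist o v := by
        rw [edist_smul_left, edist_comm v o]; ring

/-- An upper bound for the growth exponent of a quotient, in terms of a set `T` of representatives
that do not increase displacements; the base point may be moved. -/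
theorem quotientGrowthExponent_le (hN : N.Normal) (ho : edist o v ≠ ⊤) (hc : 0 ≤ c) (hC : 0 < C)
    (T : Set G) (hT : ∀ g, ∃ g' ∈ T, g⁻¹ * g' ∈ N ∧ edist v (g' • v) ≤ edist v (g • v))
    (hcount : ∀ R : ℕ, (({g ∈ T | edist v (g • v) ≤ R}.encard : ℕ∞) : ℝ≥0∞) ≤
      ENNReal.ofReal (C * (R + 1) ^ 2 * Real.exp (c * R))) :
    quotientGrowthExponent o N ≤ c := by
  set D := (edist o v).toReal with hD
  have hD0 : 0 ≤ D := ENNReal.toReal_nonneg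
  have hoD : edist v o = ENNReal.ofReal D := by rw [edist_comm, hD, ENNReal.ofReal_toReal ho]
  refine growthExponent_le (C := C * Real.exp (c * (2 * D + 2))) (K := 2 * D + 3) (by positivity)
    fun r hr => ?_
  -- The `1` makes room for an infimum that need not be attained, and `2 * D` for moving the base
  -- point. Rounding up costs one more, whence the constants `2 * D + 2` and `2 * D + 3`.
  set R := ⌈r + 1 + 2 * D⌉₊ with hR
  have hR1 : r + 1 + 2 * D ≤ R := Nat.le_ceil _
  have hR2 : (R : ℝ) < r + 1 + 2 * D + 1 := Nat.ceil_lt_add_one (by positivity)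
  have hsub : {a : G ⧸ N | quotientEDist o N ((1 : G) : G ⧸ N) a ≤ ENNReal.ofReal r} ⊆
      ((↑) : G → G ⧸ N) '' {g ∈ T | edist v (g • v) ≤ R} := by
    intro a ha
    have hlt : quotientEDist o N ((1 : G) : G ⧸ N) a < ENNReal.ofReal (r + 1) :=
      lt_of_le_of_lt ha ((ENNReal.ofReal_lt_ofReal_iff (by linarith)).2 (by linarith))
    simp only [quotientEDist, iInf_lt_iff] at hlt
    obtain ⟨n, g, hn, rfl, hlt⟩ := hlt
    have hn' : n ∈ N := by simpa using QuotientGroup.eq.1 hn.symm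
    obtain ⟨g', hg'T, hg'N, hg'⟩ := hT (n⁻¹ * g)
    refine ⟨g', ⟨hg'T, ?_⟩, ?_⟩
    · refine hg'.trans ((edist_smul_le_add v o _).trans ?_)
      rw [mul_smul, ← edist_smul_left n, smul_inv_smul, hoD]
      refine (add_le_add_left hlt.le _).trans ?_
      rw [← ENNReal.ofReal_natCast, two_mul, ← ENNReal.ofReal_add hD0 hD0,
        ← ENNReal.ofReal_add (by linarith) (by linarith)]
      exact ENNReal.ofReal_le_ofReal (by linarith)
    · refine (QuotientGroup.eq.2 ?_).symm
      -- Normality makes `n⁻¹ * g` a representative of the coset of `g`.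
      have : g⁻¹ * g' = g⁻¹ * n⁻¹ * g⁻¹⁻¹ * ((n⁻¹ * g)⁻¹ * g') := by group
      rw [this]
      have h1 := hN.conj_mem _ (N.inv_mem hn') g⁻¹
      have h2 : g⁻¹ * n⁻¹ * g⁻¹⁻¹ * ((n⁻¹ * g)⁻¹ * g') ∈ N := N.mul_mem h1 hg'N
      exact h2
  have hle : {a : G ⧸ N | quotientEDist o N ((1 : G) : G ⧸ N) a ≤ ENNReal.ofReal r}.encard ≤
      {g ∈ T | edist v (g • v) ≤ R}.encard := (Set.encard_le_encard hsub).trans (Set.encard_image_le _ _)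
  refine (ENat.toENNReal_mono hle).trans ((hcount R).trans (ENNReal.ofReal_le_ofReal ?_))
  have h0 : C * Real.exp (c * (2 * D + 2)) * (r + (2 * D + 3)) ^ 2 * Real.exp (c * r) =
      C * (r + (2 * D + 3)) ^ 2 * Real.exp (c * (2 * D + 2) + c * r) := by
    rw [Real.exp_add]; ring
  rw [h0]
  have h1 : c * R ≤ c * (2 * D + 2) + c * r := by
    rw [← mul_add]; exact mul_le_mul_of_nonneg_left (by linarith) hc
  have h2 : (R : ℝ) + 1 ≤ r + (2 * D + 3) := by linarith
  gcongr

/-- A lower bound for the growth exponent of a quotient, in terms of a set `T` of elements that lie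
in distinct cosets; the base point may be moved. -/
theorem le_quotientGrowthExponent (ho : edist o v ≠ ⊤) (hc : 0 ≤ c) (hC : 0 < C) (T : Set G)
    (hT : Set.InjOn ((↑) : G → G ⧸ N) T)
    (hcount : ∀ R : ℕ, ENNReal.ofReal (C * Real.exp (c * R)) ≤
      (({g ∈ T | edist v (g • v) ≤ R}.encard : ℕ∞) : ℝ≥0∞)) :
    c ≤ quotientGrowthExponent o N := by
  set D := (edist o v).toReal with hD
  have hD0 : 0 ≤ D := ENNReal.toReal_nonneg
  have hoD : edist o v = ENNReal.ofReal D := by rw [hD, ENNReal.ofReal_toReal ho]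
  refine le_growthExponent (C := C * Real.exp (-(c * (2 * D + 1)))) (r₀ := 2 * D) (by positivity)
    fun r hr => ?_
  set R := ⌊r - 2 * D⌋₊ with hR
  have hR1 : (R : ℝ) ≤ r - 2 * D := Nat.floor_le (by linarith)
  have hR2 : r - 2 * D < R + 1 := Nat.lt_floor_add_one _
  have hsub : ((↑) : G → G ⧸ N) '' {g ∈ T | edist v (g • v) ≤ R} ⊆
      {a : G ⧸ N | quotientEDist o N ((1 : G) : G ⧸ N) a ≤ ENNReal.ofReal r} := by
    rintro _ ⟨g, ⟨-, hg⟩, rfl⟩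
    refine (iInf_le_of_le 1 <| iInf_le_of_le g <| iInf_le_of_le rfl <| iInf_le_of_le rfl le_rfl :
      quotientEDist o N ((1 : G) : G ⧸ N) (g : G ⧸ N) ≤ edist ((1 : G) • o) (g • o)).trans ?_
    rw [one_smul]
    refine (edist_smul_le_add o v g).trans ?_
    refine (add_le_add_left hg _).trans ?_
    rw [hoD, ← ENNReal.ofReal_natCast, two_mul, ← ENNReal.ofReal_add hD0 hD0,
      ← ENNReal.ofReal_add (Nat.cast_nonneg _) (by linarith)]
    exact ENNReal.ofReal_le_ofReal (by linarith)
  have hle := Set.encard_le_encard hsub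
  rw [(hT.mono fun g hg => hg.1).encard_image] at hle
  refine le_trans (ENNReal.ofReal_le_ofReal ?_) ((hcount R).trans (ENat.toENNReal_mono hle))
  rw [mul_assoc, ← Real.exp_add]
  have h1 : -(c * (2 * D + 1)) + c * r ≤ c * R := by
    have : c * r ≤ c * (R + 1 + 2 * D) := mul_le_mul_of_nonneg_left (by linarith) hc
    linarith
  gcongr

end Action

/-- Counting the pairs in `A ×ˢ B` whose lengths satisfy `P`, if the spheres of `A` and `B` grow
with rates `α` and `β` and `α * i + β * j` is bounded for all lengths `i` and `j` that occur. -/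
theorem encard_pairs_le {G₁ G₂ : Type*} {ℓ₁ : G₁ → ℕ} {ℓ₂ : G₂ → ℕ} {A : Set G₁} {B : Set G₂}
    {α β C₁ C₂ E : ℝ} (hC₁ : 0 < C₁)
    (hA : ∀ k, ∃ S : Finset G₁, (∀ g ∈ A, ℓ₁ g = k → g ∈ S) ∧ (S.card : ℝ) ≤ C₁ * Real.exp (α * k))
    (hB : ∀ k, ∃ S : Finset G₂, (∀ g ∈ B, ℓ₂ g = k → g ∈ S) ∧ (S.card : ℝ) ≤ C₂ * Real.exp (β * k))
    (hC₂ : 0 < C₂) (R : ℕ) (P : ℕ → ℕ → Prop)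
    (hP : ∀ i j, P i j → i ≤ R ∧ j ≤ R ∧ α * i + β * j ≤ E) :
    (({g : G₁ × G₂ | g.1 ∈ A ∧ g.2 ∈ B ∧ P (ℓ₁ g.1) (ℓ₂ g.2)}.encard : ℕ∞) : ℝ≥0∞) ≤
      ENNReal.ofReal (C₁ * C₂ * (R + 1) ^ 2 * Real.exp E) := by
  classical
  choose S hS hSc using hA
  choose S' hS' hSc' using hB
  set J := ((Finset.range (R + 1)) ×ˢ (Finset.range (R + 1))).filter fun p => P p.1 p.2 with hJ
  set U := J.biUnion fun p => S p.1 ×ˢ S' p.2 with hU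
  have hsub : {g : G₁ × G₂ | g.1 ∈ A ∧ g.2 ∈ B ∧ P (ℓ₁ g.1) (ℓ₂ g.2)} ⊆ U := by
    rintro ⟨g, h⟩ ⟨hg, hh, hp⟩
    obtain ⟨h1, h2, -⟩ := hP _ _ hp
    refine Finset.mem_coe.2 (Finset.mem_biUnion.2 ⟨(ℓ₁ g, ℓ₂ h), ?_, ?_⟩)
    · exact Finset.mem_filter.2 ⟨Finset.mem_product.2
        ⟨Finset.mem_range.2 (Nat.lt_succ_of_le h1), Finset.mem_range.2 (Nat.lt_succ_of_le h2)⟩, hp⟩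
    · exact Finset.mem_product.2 ⟨hS _ _ hg rfl, hS' _ _ hh rfl⟩
  have hcard : (U.card : ℝ) ≤ C₁ * C₂ * (R + 1) ^ 2 * Real.exp E := by
    calc (U.card : ℝ) ≤ ∑ p ∈ J, ((S p.1 ×ˢ S' p.2).card : ℝ) := by
          exact_mod_cast Finset.card_biUnion_le
      _ ≤ ∑ p ∈ J, C₁ * C₂ * Real.exp E := by
          refine Finset.sum_le_sum fun p hp => ?_
          obtain ⟨-, -, hE⟩ := hP _ _ (Finset.mem_filter.1 hp).2
          rw [Finset.card_product, Nat.cast_mul]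
          calc ((S p.1).card : ℝ) * (S' p.2).card
              ≤ (C₁ * Real.exp (α * p.1)) * (C₂ * Real.exp (β * p.2)) := by
                gcongr
                · exact hSc _
                · exact hSc' _
            _ = C₁ * C₂ * Real.exp (α * p.1 + β * p.2) := by rw [Real.exp_add]; ring
            _ ≤ C₁ * C₂ * Real.exp E := by gcongr
      _ = J.card * (C₁ * C₂ * Real.exp E) := by rw [Finset.sum_const, nsmul_eq_mul]
      _ ≤ (R + 1) ^ 2 * (C₁ * C₂ * Real.exp E) := by
          gcongr
          have := Finset.card_filter_le ((Finset.range (R + 1)) ×ˢ (Finset.range (R + 1)))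
            fun p => P p.1 p.2
          rw [Finset.card_product, Finset.card_range, ← sq] at this
          exact_mod_cast this
      _ = _ := by ring
  calc _ ≤ (((U : Set (G₁ × G₂)).encard : ℕ∞) : ℝ≥0∞) :=
        ENat.toENNReal_mono (Set.encard_le_encard hsub)
    _ = ENNReal.ofReal U.card := by rw [Set.encard_coe_eq_coe_finsetCard]; simp
    _ ≤ _ := ENNReal.ofReal_le_ofReal hcard

/-! ### Products of two free groups -/

namespace FreeGroup

theorem commute_of_subsingleton {ι : Type*} [Subsingleton ι] (x y : FreeGroup ι) : Commute x y := by
  have h : ∀ (i : ι) (z : FreeGroup ι), Commute (of i) z := fun i z => by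
    induction z using FreeGroup.induction_on with
    | C1 => exact Commute.one_right _
    | of j => rw [Subsingleton.elim i j]
    | inv_of j hj => exact hj.inv_right
    | mul u v hu hv => exact hu.mul_right hv
  induction x using FreeGroup.induction_on with
  | C1 => exact Commute.one_left _
  | of j => exact h j y
  | inv_of j hj => exact hj.inv_left
  | mul u v hu hv => exact hu.mul_left hv

/-- Take a generator `j` other than the one in the first letter of `a`. Then `j a` is reduced as
written; if it equalled `a j`, comparing lengths would identify the two words, and `a` would begin
with `j`. -/
theorem exists_not_commute {ι : Type*} [Nontrivial ι] {a : FreeGroup ι} (ha : a ≠ 1) :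
    ∃ x, a * x ≠ x * a := by
  classical
  obtain ⟨⟨i, c⟩, w, hw⟩ := List.exists_cons_of_ne_nil (mt toWord_eq_nil_iff.1 ha)
  obtain ⟨j, hj⟩ := exists_ne i
  refine ⟨of j, fun h => ?_⟩
  have hred : IsReduced ((j, true) :: a.toWord) := by
    rw [hw]
    exact isReduced_cons_cons.2 ⟨fun h => absurd h hj, hw ▸ isReduced_toWord⟩
  have h1 : (of j * a).toWord = (j, true) :: a.toWord := by
    rw [toWord_mul, toWord_of, List.singleton_append, hred.reduce_eq]
  have h2 := toWord_mul_sublist a (of j)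
  rw [h, h1, toWord_of] at h2
  have h3 := h2.eq_of_length (by simp)
  rw [hw, List.cons_append, List.cons_eq_cons, Prod.mk.injEq] at h3
  exact hj h3.1.1

end FreeGroup

namespace FreeGroupBasis

variable {F ι : Type*} [Group F] [DecidableEq ι] [Fintype ι] (b : FreeGroupBasis ι F)

theorem exists_finset_norm_eq_card_le (hι : 0 < Fintype.card ι) :
    ∃ C : ℝ, 0 < C ∧ ∀ k : ℕ, ∃ S : Finset F, (∀ g ∈ Set.univ, (b.repr g).norm = k → g ∈ S) ∧
      (S.card : ℝ) ≤ C * Real.exp (Real.log (2 * Fintype.card ι - 1 : ℕ) * k) := by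
  obtain ⟨C, hC, h⟩ := FreeGroup.exists_finset_norm_eq_card_le hι
  refine ⟨C, hC, fun k => ?_⟩
  obtain ⟨S, hS, hSc⟩ := h k
  refine ⟨S.map b.repr.symm.toEquiv.toEmbedding, fun g _ hg => ?_, by rwa [Finset.card_map]⟩
  exact Finset.mem_map.2 ⟨b.repr g, hS _ hg, b.repr.symm_apply_apply g⟩

theorem exists_finset_norm_eq_le_card (hι : 0 < Fintype.card ι) (k : ℕ) :
    ∃ S : Finset F, (∀ g ∈ S, (b.repr g).norm = k) ∧
      Real.exp (Real.log (2 * Fintype.card ι - 1 : ℕ) * k) ≤ S.card := by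
  obtain ⟨S, hS, hSc⟩ := FreeGroup.exists_finset_norm_eq_le_card hι k
  refine ⟨S.map b.repr.symm.toEquiv.toEmbedding, fun g hg => ?_, by rwa [Finset.card_map]⟩
  obtain ⟨x, hx, rfl⟩ := Finset.mem_map.1 hg
  simpa using hS x hx

/-- The cosets of a nontrivial normal subgroup of a free group have representatives of minimal
length in a set that grows at a strictly smaller rate than the group. -/
theorem exists_representatives (hι : 1 < Fintype.card ι) {M : Subgroup F} (hM : M.Normal)
    {w : F} (hw : w ∈ M) (hw1 : w ≠ 1) :
    ∃ (A : Set F) (α C : ℝ), 0 ≤ α ∧ α < Real.log (2 * Fintype.card ι - 1 : ℕ) ∧ 0 < C ∧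
      (∀ g, ∃ g' ∈ A, g⁻¹ * g' ∈ M ∧ (b.repr g').norm ≤ (b.repr g).norm) ∧
      ∀ k : ℕ, ∃ S : Finset F, (∀ g ∈ A, (b.repr g).norm = k → g ∈ S) ∧
        (S.card : ℝ) ≤ C * Real.exp (α * k) := by
  obtain ⟨α, C, hα0, hα, hC, h⟩ := FreeGroup.exists_finset_avoiding hι (b.repr w)
  refine ⟨{g | ¬ (b.repr w).toWord <:+: (b.repr g).toWord}, α, C, hα0, hα, hC, fun g => ?_,
    fun k => ?_⟩
  · obtain ⟨g', h1, h2, h3⟩ := FreeGroup.exists_avoiding_representative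
      (hM.comap b.repr.symm.toMonoidHom) (w := b.repr w) (by simpa using hw) (by simpa using hw1)
      (b.repr g)
    exact ⟨b.repr.symm g', by simpa using h3, by simpa using h1, by simpa using h2⟩
  · obtain ⟨S, hS, hSc⟩ := h k
    refine ⟨S.map b.repr.symm.toEquiv.toEmbedding, fun g hgA hg => ?_, by rwa [Finset.card_map]⟩
    exact Finset.mem_map.2 ⟨b.repr g, hS _ hgA hg, b.repr.symm_apply_apply g⟩

end FreeGroupBasis

theorem Real.mul_add_mul_le_sqrt_mul_sqrt (a b c d : ℝ) :
    a * c + b * d ≤ √(a ^ 2 + b ^ 2) * √(c ^ 2 + d ^ 2) := by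
  rw [← Real.sqrt_mul (by positivity)]
  refine Real.le_sqrt_of_sq_le ?_
  nlinarith [sq_nonneg (a * d - b * c)]

/-! ### Growth tightness of the piecewise Euclidean metric. -/

namespace SalvettiCover

variable {F₁ F₂ ι₁ ι₂ : Type*} [Group F₁] [Group F₂] [DecidableEq ι₁] [DecidableEq ι₂]
  [Nonempty ι₁] [Nonempty ι₂] (b₁ : FreeGroupBasis ι₁ F₁) (b₂ : FreeGroupBasis ι₂ F₂)

theorem edist_vertex_one_ne_top (o : SalvettiCover b₁ b₂) : edist o (vertex b₁ b₂ 1) ≠ ⊤ := by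
  obtain ⟨g, hg⟩ := exists_edist_vertex_ne_top o
  refine ne_top_of_le_ne_top (ENNReal.add_ne_top.2 ⟨hg, ?_⟩) (edist_triangle _ _ _)
  rw [edist_vertex]
  exact ENNReal.ofReal_ne_top

theorem edist_vertex_one_smul (g : F₁ × F₂) :
    edist (vertex b₁ b₂ 1) (g • vertex b₁ b₂ 1) =
      ENNReal.ofReal (√((b₁.repr g.1).norm ^ 2 + (b₂.repr g.2).norm ^ 2)) := by
  have : g • vertex b₁ b₂ 1 = vertex b₁ b₂ (g * 1) := rfl
  rw [this, edist_vertex]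
  simp

/-- By Cauchy–Schwarz, `√(α² + β²) R` bounds `α i + β j` on the disc of radius `R`, and the number
of pairs `(i, j)` is only polynomial in `R`. -/
theorem quotientGrowthExponent_le_sqrt (o : SalvettiCover b₁ b₂) {N : Subgroup (F₁ × F₂)}
    (hN : N.Normal) {A : Set F₁} {B : Set F₂} {α β C₁ C₂ : ℝ} (hC₁ : 0 < C₁) (hC₂ : 0 < C₂)
    (hA : ∀ k, ∃ S : Finset F₁, (∀ g ∈ A, (b₁.repr g).norm = k → g ∈ S) ∧
      (S.card : ℝ) ≤ C₁ * Real.exp (α * k))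
    (hB : ∀ k, ∃ S : Finset F₂, (∀ g ∈ B, (b₂.repr g).norm = k → g ∈ S) ∧
      (S.card : ℝ) ≤ C₂ * Real.exp (β * k))
    (hT : ∀ g, ∃ g' : F₁ × F₂, g'.1 ∈ A ∧ g'.2 ∈ B ∧ g⁻¹ * g' ∈ N ∧
      (b₁.repr g'.1).norm ≤ (b₁.repr g.1).norm ∧ (b₂.repr g'.2).norm ≤ (b₂.repr g.2).norm) :
    quotientGrowthExponent o N ≤ (√(α ^ 2 + β ^ 2) : ℝ) := by
  refine quotientGrowthExponent_le hN (edist_vertex_one_ne_top b₁ b₂ o) (Real.sqrt_nonneg _)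
    (mul_pos hC₁ hC₂) {g | g.1 ∈ A ∧ g.2 ∈ B} (fun g => ?_) fun R => ?_
  · obtain ⟨g', h1, h2, h3, h4, h5⟩ := hT g
    refine ⟨g', ⟨h1, h2⟩, h3, ?_⟩
    rw [edist_vertex_one_smul, edist_vertex_one_smul]
    gcongr
  · refine le_trans (ENat.toENNReal_mono (Set.encard_le_encard ?_))
      (encard_pairs_le (ℓ₁ := fun g => (b₁.repr g).norm) (ℓ₂ := fun g => (b₂.repr g).norm)
        hC₁ hA hB hC₂ R (fun i j => √((i : ℝ) ^ 2 + (j : ℝ) ^ 2) ≤ R) fun i j h => ⟨?_, ?_, ?_⟩)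
    · rintro g ⟨⟨h1, h2⟩, h⟩
      rw [edist_vertex_one_smul, ← ENNReal.ofReal_natCast,
        ENNReal.ofReal_le_ofReal_iff (Nat.cast_nonneg _)] at h
      exact ⟨h1, h2, h⟩
    · have : (i : ℝ) ≤ √((i : ℝ) ^ 2 + (j : ℝ) ^ 2) := Real.le_sqrt_of_sq_le (by nlinarith)
      exact_mod_cast this.trans h
    · have : (j : ℝ) ≤ √((i : ℝ) ^ 2 + (j : ℝ) ^ 2) := Real.le_sqrt_of_sq_le (by nlinarith)
      exact_mod_cast this.trans h
    · exact (Real.mul_add_mul_le_sqrt_mul_sqrt _ _ _ _).trans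
        (mul_le_mul_of_nonneg_left h (Real.sqrt_nonneg _))

variable [Fintype ι₁] [Fintype ι₂]

/-- The product of two spheres of radius about `R / √2` lies in the ball of radius `R`. -/
theorem le_quotientGrowthExponent_bot (hcard : Fintype.card ι₁ = Fintype.card ι₂)
    (o : SalvettiCover b₁ b₂) :
    ((√2 * Real.log (2 * Fintype.card ι₁ - 1 : ℕ) : ℝ) : EReal) ≤
      quotientGrowthExponent o (⊥ : Subgroup (F₁ × F₂)) := by
  have hι := Fintype.card_pos (α := ι₁)
  set h := Real.log (2 * Fintype.card ι₁ - 1 : ℕ) with hh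
  have hh0 : 0 ≤ h := Real.log_nonneg (by exact_mod_cast (by omega))
  -- Rounding `R / √2` down loses less than one in each factor, hence a factor of at most `exp (2 *
  -- h)`.
  refine le_quotientGrowthExponent (C := Real.exp (-(2 * h))) (edist_vertex_one_ne_top b₁ b₂ o)
    (by positivity) (Real.exp_pos _) Set.univ (fun x _ y _ hxy => ?_) fun R => ?_
  · simpa [QuotientGroup.eq, inv_mul_eq_one] using hxy
  set a := ⌊(R : ℝ) / √2⌋₊ with ha
  have h2 : √2 * √2 = (2 : ℝ) := Real.mul_self_sqrt (by norm_num)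
  have ha1 : (a : ℝ) ≤ R / √2 := Nat.floor_le (by positivity)
  have ha2 : (R : ℝ) / √2 < a + 1 := Nat.lt_floor_add_one _
  rw [le_div_iff₀ (by positivity)] at ha1
  rw [div_lt_iff₀ (by positivity)] at ha2
  obtain ⟨S, hS, hSc⟩ := b₁.exists_finset_norm_eq_le_card hι a
  obtain ⟨S', hS', hSc'⟩ := b₂.exists_finset_norm_eq_le_card (hcard ▸ hι) a
  rw [← hcard] at hSc'
  rw [← hh] at hSc hSc'
  have hsub : ((S ×ˢ S' : Finset (F₁ × F₂)) : Set (F₁ × F₂)) ⊆ {g ∈ Set.univ |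
      edist (vertex b₁ b₂ 1) (g • vertex b₁ b₂ 1) ≤ R} := by
    rintro g hg
    obtain ⟨h1, h2'⟩ := Finset.mem_product.1 (Finset.mem_coe.1 hg)
    refine ⟨trivial, ?_⟩
    rw [edist_vertex_one_smul, hS _ h1, hS' _ h2', ← ENNReal.ofReal_natCast]
    refine ENNReal.ofReal_le_ofReal (Real.sqrt_le_iff.2 ⟨Nat.cast_nonneg _, ?_⟩)
    have : ((a : ℝ) * √2) ^ 2 ≤ R ^ 2 := by gcongr
    nlinarith
  refine le_trans ?_ (ENat.toENNReal_mono (Set.encard_le_encard hsub))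
  rw [Set.encard_coe_eq_coe_finsetCard, ENat.toENNReal_coe, ← ENNReal.ofReal_natCast]
  refine ENNReal.ofReal_le_ofReal ?_
  rw [Finset.card_product, Nat.cast_mul, ← Real.exp_add]
  refine le_trans ?_ (mul_le_mul hSc hSc' (Real.exp_pos _).le (Nat.cast_nonneg _))
  rw [← Real.exp_add]
  refine Real.exp_le_exp.2 ?_
  have : √2 * R ≤ 2 * (a + 1) := by
    have := mul_le_mul_of_nonneg_left ha2.le (Real.sqrt_nonneg 2)
    nlinarith
  nlinarith [mul_le_mul_of_nonneg_left this hh0]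

/-- The action of a product of two free groups of the same rank on the product of their Cayley
trees with the piecewise Euclidean metric is growth tight. -/
theorem isGrowthTight (hcard : Fintype.card ι₁ = Fintype.card ι₂) (hι : 1 < Fintype.card ι₁)
    (o : SalvettiCover b₁ b₂) : IsGrowthTight (F₁ × F₂) o := by
  intro N hN hinf
  have : Nontrivial ι₁ := Fintype.one_lt_card_iff_nontrivial.1 hι
  have : Nontrivial ι₂ := Fintype.one_lt_card_iff_nontrivial.1 (hcard ▸ hι)
  refine lt_of_lt_of_le ?_ (le_quotientGrowthExponent_bot b₁ b₂ hcard o)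
  set h := Real.log (2 * Fintype.card ι₁ - 1 : ℕ) with hh
  have hh0 : 0 ≤ h := Real.log_nonneg (by exact_mod_cast (by omega))
  have lt : ∀ α : ℝ, 0 ≤ α → α < h → √(α ^ 2 + h ^ 2) < √2 * h := fun α h0 hα => by
    rw [Real.sqrt_lt' (by have := h0.trans_lt hα; positivity), mul_pow, Real.sq_sqrt zero_le_two]
    nlinarith
  obtain ⟨C₁, hC₁, hcount₁⟩ := b₁.exists_finset_norm_eq_card_le (by omega)
  obtain ⟨C₂, hC₂, hcount₂⟩ := b₂.exists_finset_norm_eq_card_le (by omega)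
  rw [← hcard, ← hh] at hcount₂
  rw [← hh] at hcount₁
  obtain ⟨⟨⟨x, y⟩, hxy⟩, hne⟩ := exists_ne (1 : N)
  have hne : (x, y) ≠ 1 := fun h => hne (Subtype.ext h)
  by_cases hx : x = 1
  · have hy : y ≠ 1 := fun hy => hne (by rw [hx, hy]; rfl)
    obtain ⟨z, hz⟩ : ∃ z, y * z ≠ z * y := by
      obtain ⟨z, hz⟩ := FreeGroup.exists_not_commute (a := b₂.repr y) (by simpa using hy)
      exact ⟨b₂.repr.symm z, fun h => hz (by simpa using congrArg b₂.repr h)⟩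
    -- The commutator of `(x, y)` with `(1, z)` has trivial first coordinate.
    have hmem : y * z * y⁻¹ * z⁻¹ ∈ N.comap (MonoidHom.inr F₁ F₂) := by
      have := N.mul_mem hxy (hN.conj_mem _ (N.inv_mem hxy) (1, z))
      simpa [mul_assoc] using this
    obtain ⟨A, α, C, hα0, hα, hC, hrep, hA⟩ := b₂.exists_representatives (hcard ▸ hι)
      (hN.comap _) hmem (fun h => hz (by rwa [mul_inv_eq_one, mul_inv_eq_iff_eq_mul] at h))
    rw [← hcard, ← hh] at hα
    refine lt_of_le_of_lt (quotientGrowthExponent_le_sqrt b₁ b₂ o hN hC₁ hC hcount₁ hA fun g => ?_)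
      (EReal.coe_lt_coe_iff.2 (by rw [add_comm]; exact lt α hα0 hα))
    obtain ⟨g', h1, h2, h3⟩ := hrep g.2
    -- Only the coordinate in which `N` has a nontrivial element is replaced; the other keeps the
    -- full rate `h`.
    refine ⟨(g.1, g'), trivial, h1, ?_, le_rfl, h3⟩
    have : g⁻¹ * (g.1, g') = MonoidHom.inr F₁ F₂ (g.2⁻¹ * g') :=
      Prod.ext (inv_mul_cancel g.1) rfl
    rwa [this]
  · obtain ⟨z, hz⟩ : ∃ z, x * z ≠ z * x := by
      obtain ⟨z, hz⟩ := FreeGroup.exists_not_commute (a := b₁.repr x) (by simpa using hx)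
      exact ⟨b₁.repr.symm z, fun h => hz (by simpa using congrArg b₁.repr h)⟩
    have hmem : x * z * x⁻¹ * z⁻¹ ∈ N.comap (MonoidHom.inl F₁ F₂) := by
      have := N.mul_mem hxy (hN.conj_mem _ (N.inv_mem hxy) (z, 1))
      simpa [mul_assoc] using this
    obtain ⟨A, α, C, hα0, hα, hC, hrep, hA⟩ := b₁.exists_representatives hι
      (hN.comap _) hmem (fun h => hz (by rwa [mul_inv_eq_one, mul_inv_eq_iff_eq_mul] at h))
    refine lt_of_le_of_lt (quotientGrowthExponent_le_sqrt b₁ b₂ o hN hC hC₂ hA hcount₂ fun g => ?_)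
      (EReal.coe_lt_coe_iff.2 (lt α hα0 hα))
    obtain ⟨g', h1, h2, h3⟩ := hrep g.1
    refine ⟨(g', g.2), h1, trivial, ?_, h3, le_rfl⟩
    have : g⁻¹ * (g', g.2) = MonoidHom.inl F₁ F₂ (g.1⁻¹ * g') :=
      Prod.ext rfl (inv_mul_cancel g.2)
    rwa [this]

end SalvettiCover

/-! ### Failure of growth tightness for the 1-skeleton. -/

namespace SalvettiSkeleton

variable {F₁ F₂ ι₁ ι₂ : Type*} [Group F₁] [Group F₂] [DecidableEq ι₁] [DecidableEq ι₂]
  (b₁ : FreeGroupBasis ι₁ F₁) (b₂ : FreeGroupBasis ι₂ F₂)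

theorem edist_vertex_one_smul (g : F₁ × F₂) :
    edist (vertex b₁ b₂ 1) (g • vertex b₁ b₂ 1) =
      ENNReal.ofReal ((b₁.repr g.1).norm + (b₂.repr g.2).norm) := by
  have : g • vertex b₁ b₂ 1 = vertex b₁ b₂ (g * 1) := rfl
  rw [this, edist_vertex]
  simp

variable [Nonempty ι₁] [Nonempty ι₂]

theorem edist_vertex_one_ne_top (o : SalvettiSkeleton b₁ b₂) : edist o (vertex b₁ b₂ 1) ≠ ⊤ := by
  obtain ⟨g, hg⟩ := exists_edist_vertex_ne_top o
  refine ne_top_of_le_ne_top (ENNReal.add_ne_top.2 ⟨hg, ?_⟩) (edist_triangle _ _ _)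
  rw [edist_vertex]
  exact ENNReal.ofReal_ne_top

variable [Fintype ι₁] [Fintype ι₂]

/-- The action of a product of two free groups of the same rank on the 1-skeleton of the product of
their Cayley trees is not growth tight: the quotient by a factor has the same growth exponent. -/
theorem not_isGrowthTight (hcard : Fintype.card ι₁ = Fintype.card ι₂)
    (o : SalvettiSkeleton b₁ b₂) : ¬ IsGrowthTight (F₁ × F₂) o := by
  intro htight
  have hι := Fintype.card_pos (α := ι₁)
  set h := Real.log (2 * Fintype.card ι₁ - 1 : ℕ) with hh
  have hh0 : 0 ≤ h := Real.log_nonneg (by exact_mod_cast (by omega))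
  have hinf : Infinite ((⊥ : Subgroup F₁).prod (⊤ : Subgroup F₂)) := by
    have h1 : Function.Injective fun n : ℕ => (b₂ (Classical.arbitrary ι₂)) ^ n := fun m n hmn => by
      have := congrArg (fun g => (b₂.repr g).norm) hmn
      simpa [FreeGroup.norm_of_pow] using this
    refine Infinite.of_injective (fun n : ℕ => (⟨(1, (b₂ (Classical.arbitrary ι₂)) ^ n),
      Subgroup.mem_prod.2 ⟨Subgroup.mem_bot.2 rfl, Subgroup.mem_top _⟩⟩ :
        (⊥ : Subgroup F₁).prod (⊤ : Subgroup F₂))) fun m n hmn => h1 ?_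
    exact congrArg (fun g => g.1.2) hmn
  refine (htight _ (Subgroup.prod_normal ⊥ ⊤) hinf).not_ge (le_trans (b := (h : EReal)) ?_ ?_)
  · obtain ⟨C₁, hC₁, hA⟩ := b₁.exists_finset_norm_eq_card_le hι
    obtain ⟨C₂, hC₂, hB⟩ := b₂.exists_finset_norm_eq_card_le (hcard ▸ hι)
    rw [← hcard, ← hh] at hB
    rw [← hh] at hA
    refine quotientGrowthExponent_le inferInstance (edist_vertex_one_ne_top b₁ b₂ o) hh0
      (mul_pos hC₁ hC₂) Set.univ (fun g => ⟨g, trivial, by simp, le_rfl⟩) fun R => ?_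
    refine le_trans (ENat.toENNReal_mono (Set.encard_le_encard ?_))
      (encard_pairs_le (ℓ₁ := fun g => (b₁.repr g).norm) (ℓ₂ := fun g => (b₂.repr g).norm)
        hC₁ hA hB hC₂ R (fun i j => (i : ℝ) + j ≤ R) fun i j hij => ⟨?_, ?_, ?_⟩)
    · rintro g ⟨-, hg⟩
      rw [edist_vertex_one_smul, ← ENNReal.ofReal_natCast,
        ENNReal.ofReal_le_ofReal_iff (Nat.cast_nonneg _)] at hg
      exact ⟨trivial, trivial, hg⟩
    · have : i + j ≤ R := by exact_mod_cast hij
      omega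
    · have : i + j ≤ R := by exact_mod_cast hij
      omega
    · rw [← mul_add]
      exact mul_le_mul_of_nonneg_left hij hh0
  -- Elements of the first factor represent distinct cosets of the second, so its spheres already
  -- give the rate `h`.
  · refine le_quotientGrowthExponent (edist_vertex_one_ne_top b₁ b₂ o) hh0 one_pos
      {g | g.2 = 1} (fun x hx y hy hxy => ?_) fun R => ?_
    · have := QuotientGroup.eq.1 hxy
      rw [Subgroup.mem_prod, Subgroup.mem_bot] at this
      exact Prod.ext (inv_mul_eq_one.1 this.1) (Eq.trans hx (Eq.symm hy))
    · obtain ⟨S, hS, hSc⟩ := b₁.exists_finset_norm_eq_le_card hι R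
      have hsub : ((S ×ˢ {1} : Finset (F₁ × F₂)) : Set (F₁ × F₂)) ⊆ {g ∈ {g | g.2 = 1} |
          edist (vertex b₁ b₂ 1) (g • vertex b₁ b₂ 1) ≤ R} := by
        rintro g hg
        obtain ⟨h1, h2⟩ := Finset.mem_product.1 (Finset.mem_coe.1 hg)
        have h2 : g.2 = 1 := Finset.mem_singleton.1 h2
        refine ⟨h2, ?_⟩
        rw [edist_vertex_one_smul, hS _ h1, h2]
        simp
      refine le_trans ?_ (ENat.toENNReal_mono (Set.encard_le_encard hsub))
      rw [Set.encard_coe_eq_coe_finsetCard, ENat.toENNReal_coe, ← ENNReal.ofReal_natCast,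
        Finset.card_product, Finset.card_singleton, mul_one, one_mul]
      exact ENNReal.ofReal_le_ofReal hSc

end SalvettiSkeleton

theorem mainTheorem4 {F : Type*} [Group F] (hF : ∃ x y : F, x * y ≠ y * x)
    {ι₁ ι₂ : Type*} [Finite ι₁] [Finite ι₂]
    (b₁ : FreeGroupBasis ι₁ F) (b₂ : FreeGroupBasis ι₂ F) :
    (∀ g h : F × F,
      edist (SalvettiCover.vertex b₁ b₂ g) (SalvettiCover.vertex b₁ b₂ h) =
        edist (WithLp.toLp 2 (CayleyGraph.vertex (s := b₁) g.1, CayleyGraph.vertex (s := b₂) g.2))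
          (WithLp.toLp 2 (CayleyGraph.vertex (s := b₁) h.1, CayleyGraph.vertex (s := b₂) h.2))) ∧
    (∀ o : SalvettiCover b₁ b₂, IsGrowthTight (F × F) o) ∧
    (∀ g h : F × F,
      edist (SalvettiSkeleton.vertex b₁ b₂ g) (SalvettiSkeleton.vertex b₁ b₂ h) =
        edist (WithLp.toLp 1 (CayleyGraph.vertex (s := b₁) g.1, CayleyGraph.vertex (s := b₂) g.2))
          (WithLp.toLp 1 (CayleyGraph.vertex (s := b₁) h.1, CayleyGraph.vertex (s := b₂) h.2))) ∧
    (∀ o : SalvettiSkeleton b₁ b₂, ¬ IsGrowthTight (F × F) o) := by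
  classical
  cases nonempty_fintype ι₁
  cases nonempty_fintype ι₂
  -- Bases of the same group have equal cardinality, so both trees have the same rate `h`.
  have hcard : Fintype.card ι₁ = Fintype.card ι₂ :=
    Fintype.card_congr (Equiv.ofFreeGroupEquiv (b₁.repr.symm.trans b₂.repr))
  have hι : 1 < Fintype.card ι₁ := by
    by_contra hle
    have : Subsingleton ι₁ := Fintype.card_le_one_iff_subsingleton.1 (not_lt.1 hle)
    obtain ⟨x, y, hxy⟩ := hF
    refine hxy (b₁.repr.injective ?_)
    rw [map_mul, map_mul]
    exact FreeGroup.commute_of_subsingleton _ _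
  have : Nonempty ι₁ := Fintype.card_pos_iff.1 (by omega)
  have : Nonempty ι₂ := Fintype.card_pos_iff.1 (by omega)
  refine ⟨fun g h => ?_, SalvettiCover.isGrowthTight b₁ b₂ hcard hι, fun g h => ?_,
    SalvettiSkeleton.not_isGrowthTight b₁ b₂ hcard⟩
  · rw [SalvettiCover.edist_vertex]
    exact (WithLp.edist_eq_ofReal_sqrt (Nat.cast_nonneg _) (Nat.cast_nonneg _)
      (CayleyGraph.edist_vertex b₁ g.1 h.1) (CayleyGraph.edist_vertex b₂ g.2 h.2)).symm
  · rw [SalvettiSkeleton.edist_vertex, WithLp.prod_edist_eq_add (by norm_num),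
      ENNReal.ofReal_add (Nat.cast_nonneg _) (Nat.cast_nonneg _)]
    simp only [ENNReal.toReal_one, ENNReal.rpow_one, div_one]
    exact congrArg₂ (· + ·) (CayleyGraph.edist_vertex b₁ g.1 h.1).symm
      (CayleyGraph.edist_vertex b₂ g.2 h.2).symm
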